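/- Let $q>2$ be an even prime power and let $\mathcal Q$ be an oval cone in $\mathrm{PG}(3,q)$, i.e. the union of the lines $\langle R,P\rangle$ with $P\in\mathcal O$, where $\mathcal O$ is an oval ($q+1$ points, no three collinear) in some plane and $R$ is a point not in that plane. Let $L=(\mathcal P,\mathcal B)$ be the ovoidal Laguerre plane of order $q$ defined by $\mathcal Q$: $\mathcal P$ is the set of non-singular points of $\mathcal Q$ (a point $P\in\mathcal Q$ being singular if every line through $P$ either meets $\mathcal Q$ only in $P$ or is contained in $\mathcal Q$), and the circles, i.e. the elements of $\mathcal B$, are the intersections $\mathcal Q\cap\pi$ with those planes $\pi$ for which $\mathcal Q\cap\pi$ is an oval of $\pi$. An intersecting family is a set $\mathcal F\subseteq\mathcal B$ any two members of which have a common point. The nucleus of a circle $\mathcal Q\cap\pi$ is the point $N\in\pi\setminus\mathcal Q$ such that the lines of $\pi$ meeting $\mathcal Q\cap\pi$ in exactly one point are exactly the lines of $\pi$ through $N$. 1. Every intersecting family $\mathcal F$ satisfies $|\mathcal F|\le q^2$. 2. The intersecting families $\mathcal F$ with $|\mathcal F|=q^2$ are exactly the following sets of circles: the set of all circles through $P$,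 for a point $P\in\mathcal P$; and the set consisting of a circle $c\in\mathcal B$ together with all circles that meet $c$ in exactly one point. 3. The sets of the second kind in part 2 are exactly the sets consisting of all circles with nucleus $N$, where $N$ is the nucleus of some circle. -/

import Mathlib

open scoped LinearAlgebra.Projectivization

namespace CircleGeometry

variable {K V : Type*} [Field K] [AddCommGroup V] [Module K V]

/-- A projective line: a projective subspace whose underlying vector space has dimension `2`. -/
def IsLine (l : Projectivization.Subspace K V) : Prop :=
  Module.finrank K l.submodule = 2

/-- A projective plane: a projective subspace whose underlying vector space has dimension `3`. -/
def IsPlane (π : Projectivization.Subspace K V) : Prop :=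
  Module.finrank K π.submodule = 3

/-- `O` is an oval of the plane `π` over the field with `q` elements: a set of `q + 1` points of
`π`, no three of which are collinear. -/
def IsOvalOf (π : Projectivization.Subspace K V) (O : Set (ℙ K V)) : Prop :=
  O ⊆ (π : Set (ℙ K V)) ∧ O.ncard = Nat.card K + 1 ∧
    ∀ a ∈ O, ∀ b ∈ O, ∀ c ∈ O, a ≠ b → a ≠ c → b ≠ c →
      ¬ Projectivization.IsCollinear ({a, b, c} : Set (ℙ K V))

/-- `Q` is an oval cone: the union of the lines joining a vertex `R` to the points of an oval `O`
lying in some plane that does not contain `R`. -/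
def IsOvalCone (Q : Set (ℙ K V)) : Prop :=
  ∃ (R : ℙ K V) (π : Projectivization.Subspace K V) (O : Set (ℙ K V)),
    IsPlane π ∧ R ∉ π ∧ IsOvalOf π O ∧
      Q = ⋃ P ∈ O, (Projectivization.Subspace.span {R, P} : Set (ℙ K V))

/-- `P` is a singular point of `Q`: every line through the point `P` of `Q` either meets `Q` in `P`
only or is contained in `Q`. -/
def IsSingularPoint (Q : Set (ℙ K V)) (P : ℙ K V) : Prop :=
  P ∈ Q ∧ ∀ l : Projectivization.Subspace K V, IsLine l → P ∈ l →
    (l : Set (ℙ K V)) ∩ Q = {P} ∨ (l : Set (ℙ K V)) ⊆ Q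

/-- The points of the circle geometry of `Q`: the non-singular points of `Q`. -/
def points (Q : Set (ℙ K V)) : Set (ℙ K V) :=
  {P | P ∈ Q ∧ ¬ IsSingularPoint Q P}

/-- The circles of the circle geometry of `Q`: the intersections of `Q` with its oval planes, the
planes that meet `Q` in an oval. -/
def circles (Q : Set (ℙ K V)) : Set (Set (ℙ K V)) :=
  {c | ∃ π : Projectivization.Subspace K V,
    IsPlane π ∧ IsOvalOf π (Q ∩ π) ∧ c = Q ∩ π}

/-- `F` is an intersecting family of circles of the circle geometry of `Q`: a set of circles any two
of which have a point in common. -/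
def IsIntersectingFamily (Q : Set (ℙ K V)) (F : Set (Set (ℙ K V))) : Prop :=
  F ⊆ circles Q ∧ ∀ c ∈ F, ∀ d ∈ F, (c ∩ d).Nonempty

/-- `N` is a nucleus of the oval `O`: for the plane `π` of `O`, the point `N` lies in `π` but not on
`O`, and the lines of `π` tangent to `O` (those meeting `O` in exactly one point) are exactly the
lines of `π` through `N`. -/
def IsNucleus (O : Set (ℙ K V)) (N : ℙ K V) : Prop :=
  ∃ π : Projectivization.Subspace K V, IsPlane π ∧ IsOvalOf π O ∧ N ∈ π ∧ N ∉ O ∧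
    ∀ l : Projectivization.Subspace K V, IsLine l → l ≤ π →
      (((l : Set (ℙ K V)) ∩ O).ncard = 1 ↔ N ∈ l)

/-- `F` consists of all circles through some fixed point. -/
def IsPointPencil (Q : Set (ℙ K V)) (F : Set (Set (ℙ K V))) : Prop :=
  ∃ P ∈ points Q, F = {c | c ∈ circles Q ∧ P ∈ c}

/-- `F` consists of some circle `c` and all circles meeting `c` in exactly one point. -/
def IsTangentFamily (Q : Set (ℙ K V)) (F : Set (Set (ℙ K V))) : Prop :=
  ∃ c ∈ circles Q, F = {d | d ∈ circles Q ∧ (d = c ∨ (c ∩ d).ncard = 1)}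

/-- `F` consists of all circles with nucleus `N`, for some fixed nucleus `N` of some circle. -/
def IsNucleusFamily (Q : Set (ℙ K V)) (F : Set (Set (ℙ K V))) : Prop :=
  ∃ N : ℙ K V, (∃ c ∈ circles Q, IsNucleus c N) ∧ F = {c | c ∈ circles Q ∧ IsNucleus c N}

end CircleGeometry

set_option linter.unusedSectionVars false

/-! Write the four-space as W × K with the vertex spanning the second factor. The planes that miss
the vertex are the graphs of the functionals on the three-space W, so circles correspond to the q^3
functionals, and two circles meet where their functionals agree on an oval vector. Since q is even,
the oval extends by its nucleus to a hyperoval of q + 2 vectors, any three of them a basis of W. A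
nonzero functional vanishes at 0 or 2 hyperoval vectors. Hence two distinct functionals that agree
at the nucleus agree at exactly one oval vector. So distinct circles touch iff their functionals
agree at the nucleus, which is also when they have the same nucleus, and circles meet iff their
functionals agree somewhere on the hyperoval. Point pencils and tangent families thus become the
fibres of q + 2 evaluation forms that play symmetric roles, and the theorem becomes an Erdős–Ko–Rado
statement for an MDS code of length q + 2 and dimension 3.

Bound: if e vanishes at no form, the q translates F + c e are pairwise disjoint, so q |F| ≤ q^3
(`IsMDS.card_le`).

Equality: the translates now tile the space for every such e. This fixes how many members of F
differ from a given g by a nowhere vanishing element, and hence the sum over the forms i of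
n_i(g_i), where n_i(s) counts the members of F with value s at i (`IsMDS.sum_valueCount_eq`).
Summing over the g with two prescribed values gives n_i(s) + n_j(t) = q + q m, with m the number of
members having both values (`IsMDS.valueCount_add`). A second moment count then shows that n_i(s)^2
- q^2 n_i(s) does not depend on s, so two values of n_i are equal or add up to q^2. As q > 2, some
n_i(s) equals q^2, and F is a fibre. -/

namespace CircleGeometry

open Finset

/-! ### Three-dimensional MDS codes: fibre sizes and numbers of zeros. -/

section Code

variable {K M ι : Type*} [Field K] [AddCommGroup M] [Module K M]

/-- A system of linear forms of which any three distinct ones are coordinates of the space. -/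
def IsMDS (ev : ι → M →ₗ[K] K) : Prop :=
  ∀ i j k, i ≠ j → i ≠ k → j ≠ k → Function.Bijective fun g => (ev i g, ev j g, ev k g)

variable [Fintype K] [DecidableEq K] [Fintype M] [DecidableEq M] [Fintype ι] [DecidableEq ι]
  {ev : ι → M →ₗ[K] K}

theorem IsMDS.card_fiber_three (h : IsMDS ev) {i j k : ι} (hij : i ≠ j) (hik : i ≠ k) (hjk : j ≠ k)
    (s t u : K) : #{g | (ev i g = s ∧ ev j g = t) ∧ ev k g = u} = 1 := by
  obtain ⟨g, hg⟩ := (h i j k hij hik hjk).2 (s, t, u)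
  rw [card_eq_one]
  refine ⟨g, ?_⟩
  ext x
  simp only [mem_filter, mem_univ, true_and, mem_singleton]
  constructor
  · rintro ⟨⟨h1, h2⟩, h3⟩
    apply (h i j k hij hik hjk).1
    simp only [hg, h1, h2, h3]
  · rintro rfl
    simp only [Prod.mk.injEq] at hg
    tauto

theorem IsMDS.sum_fiber_two (h : IsMDS ev) {i j k : ι} (hij : i ≠ j) (hik : i ≠ k) (hjk : j ≠ k)
    (s t : K) (φ : K → ℤ) : ∑ g with ev i g = s ∧ ev j g = t, φ (ev k g) = ∑ u, φ u := by
  rw [← sum_fiberwise']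
  refine sum_congr rfl fun u _ => ?_
  rw [filter_filter, sum_const, h.card_fiber_three hij hik hjk, one_smul]

theorem exists_ne_ne (hι : 2 < Fintype.card ι) (i j : ι) : ∃ k, i ≠ k ∧ j ≠ k := by
  by_contra! hc
  have : (univ : Finset ι) ⊆ {i, j} := fun k _ => by
    by_cases hk : i = k
    · simp [hk]
    · simp [hc k hk]
  have := (card_le_card this).trans card_le_two
  rw [card_univ] at this
  omega

theorem IsMDS.card_fiber_two (h : IsMDS ev) (hι : 2 < Fintype.card ι) {i j : ι} (hij : i ≠ j)
    (s t : K) : #{g | ev i g = s ∧ ev j g = t} = Fintype.card K := by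
  obtain ⟨k, hik, hjk⟩ := exists_ne_ne hι i j
  have := h.sum_fiber_two hij hik hjk s t 1
  simpa using this

theorem IsMDS.card_fiber (h : IsMDS ev) (hι : 2 < Fintype.card ι) (i : ι)
    (s : K) : #{g | ev i g = s} = Fintype.card K ^ 2 := by
  obtain ⟨j, hij, -⟩ := exists_ne_ne hι i i
  rw [card_eq_sum_card_fiberwise (f := ev j) (t := univ) (fun _ _ => by simp)]
  simp_rw [filter_filter, h.card_fiber_two hι hij]
  simp [sq]

theorem IsMDS.card_eq (h : IsMDS ev) (hι : 2 < Fintype.card ι) :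
    Fintype.card M = Fintype.card K ^ 3 := by
  obtain ⟨i⟩ : Nonempty ι := Fintype.card_pos_iff.1 (by omega)
  rw [← card_univ, card_eq_sum_card_fiberwise (f := ev i) (t := univ) (fun _ _ => by simp)]
  simp_rw [h.card_fiber hι]
  simp [pow_succ, mul_comm]

/-- The number of forms vanishing at `g`. -/
def zeros (ev : ι → M →ₗ[K] K) (g : M) : ℕ := #{i | ev i g = 0}

theorem zeros_zero : zeros ev 0 = Fintype.card ι := by simp [zeros]

theorem zeros_smul {c : K} (hc : c ≠ 0) (g : M) : zeros ev (c • g) = zeros ev g := by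
  simp [zeros, hc]

theorem IsMDS.zeros_le_two (h : IsMDS ev) {g : M} (hg : g ≠ 0) : zeros ev g ≤ 2 := by
  by_contra! hc
  obtain ⟨i, j, k, hi, hj, hk, hij, hik, hjk⟩ := two_lt_card_iff.1 hc
  simp only [mem_filter, mem_univ, true_and] at hi hj hk
  exact hg ((h i j k hij hik hjk).1 (by simp [hi, hj, hk]))

theorem card_zeros_erase {g : M} {i : ι} (hi : ev i g = 0) :
    #{j ∈ univ.erase i | ev j g = 0} + 1 = zeros ev g := by
  rw [zeros, filter_erase, card_erase_add_one]
  simp [hi]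

/-- The number of nonzero `g` at which the form `i` and no other form vanishes. -/
theorem IsMDS.card_tangent (h : IsMDS ev) (hι : 2 < Fintype.card ι) (i : ι) :
    #{g | ev i g = 0 ∧ zeros ev g = 1} + (Fintype.card ι - 1) * (Fintype.card K - 1) + 1
      = Fintype.card K ^ 2 := by
  have hK : 1 ≤ Fintype.card K := Fintype.card_pos
  -- Double count pairs of an element killed by i and a further form killing it. A nonzero element
  -- occurs in at most one pair, and in none exactly when i is its only zero.
  have key : ∑ g with ev i g = 0, #{j ∈ univ.erase i | ev j g = 0}
      = (Fintype.card ι - 1) * Fintype.card K := by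
    have hswap := sum_card_bipartiteAbove_eq_sum_card_bipartiteBelow
      (s := ({g | ev i g = 0} : Finset M)) (t := univ.erase i) fun g j => ev j g = 0
    simp only [bipartiteAbove, bipartiteBelow] at hswap
    rw [hswap, sum_congr rfl (g := fun _ => Fintype.card K), sum_const, card_erase_of_mem (mem_univ _),
      card_univ, smul_eq_mul]
    intro j hj
    rw [filter_filter, h.card_fiber_two hι (ne_of_mem_erase hj).symm]
  have h0 : (0 : M) ∈ ({g | ev i g = 0} : Finset M) := by simp
  rw [← add_sum_erase _ _ h0] at key
  have hz : #{j ∈ univ.erase i | ev j (0 : M) = 0} = Fintype.card ι - 1 := by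
    simp [card_erase_of_mem]
  rw [hz] at key
  have hcard := h.card_fiber hι i 0
  rw [← card_erase_add_one h0] at hcard
  have hsplit : ∑ g ∈ ({g | ev i g = 0} : Finset M).erase 0, #{j ∈ univ.erase i | ev j g = 0}
      + #{g | ev i g = 0 ∧ zeros ev g = 1} = #(({g | ev i g = 0} : Finset M).erase 0) := by
    have : ({g | ev i g = 0 ∧ zeros ev g = 1} : Finset M)
        = {g ∈ ({g | ev i g = 0} : Finset M).erase 0 | zeros ev g = 1} := by
      ext g
      simp only [mem_filter, mem_univ, true_and, mem_erase]
      constructor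
      · rintro ⟨h1, h2⟩
        refine ⟨⟨?_, h1⟩, h2⟩
        rintro rfl
        rw [zeros_zero] at h2
        omega
      · tauto
    rw [this, card_filter, ← sum_add_distrib, card_eq_sum_ones]
    refine sum_congr rfl fun g hg => ?_
    simp only [mem_filter, mem_univ, true_and, mem_erase] at hg
    have h1 := card_zeros_erase hg.2
    have h2 := h.zeros_le_two hg.1
    split_ifs <;> omega
  obtain ⟨q, hq⟩ := Nat.exists_eq_add_of_le' hK
  obtain ⟨m, hm⟩ := Nat.exists_eq_add_of_le' (show 1 ≤ Fintype.card ι by omega)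
  rw [hq, hm] at key ⊢
  rw [hq] at hcard
  simp only [Nat.add_sub_cancel] at key ⊢
  linarith

/-- With q + 2 forms, `IsMDS.card_tangent` leaves q^2 - 1 - (q + 1)(q - 1) = 0 elements having i as
their only zero. -/
theorem IsMDS.zeros_eq (h : IsMDS ev) (hι : Fintype.card ι = Fintype.card K + 2) {g : M}
    (hg : g ≠ 0) : zeros ev g = 0 ∨ zeros ev g = 2 := by
  have hK : 1 ≤ Fintype.card K := Fintype.card_pos
  have h2 := h.zeros_le_two hg
  by_contra! hc
  have h1 : zeros ev g = 1 := by omega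
  obtain ⟨i, hi⟩ := card_pos.1 (show 0 < #{i | ev i g = 0} by rw [zeros] at h1; omega)
  have ht := h.card_tangent (by omega) i
  have : 0 < #{g | ev i g = 0 ∧ zeros ev g = 1} := card_pos.2 ⟨g, by simpa [h1] using hi⟩
  rw [hι] at ht
  obtain ⟨q, hq⟩ := Nat.exists_eq_add_of_le' hK
  rw [hq] at ht
  simp only [Nat.add_sub_cancel, show q + 1 + 2 - 1 = q + 2 by omega] at ht
  nlinarith

end Code

/-! ### Intersecting families in an MDS code of length q + 2. -/

section Family

variable {K M ι : Type*} [Field K] [AddCommGroup M] [Module K M]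
  [Fintype K] [DecidableEq K] [Fintype M] [DecidableEq M] [Fintype ι] [DecidableEq ι]
  {ev : ι → M →ₗ[K] K}

/-- The elements at which no form vanishes. -/
def externals (ev : ι → M →ₗ[K] K) : Finset M := {e | zeros ev e = 0}

theorem mem_externals {e : M} : e ∈ externals ev ↔ ∀ i, ev i e ≠ 0 := by
  simp [externals, zeros, filter_eq_empty_iff]

theorem smul_mem_externals {e : M} {c : K} (hc : c ≠ 0) :
    c • e ∈ externals ev ↔ e ∈ externals ev := by
  simp [mem_externals, hc]

/-- Puts the alternative "0 or 2 zeros" in a form that can be summed; the last term corrects for g =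
0, where all q + 2 forms vanish. -/
theorem IsMDS.zeros_eq_ite (h : IsMDS ev) (hι : Fintype.card ι = Fintype.card K + 2) (g : M) :
    (zeros ev g : ℤ) =
      2 - 2 * (if g ∈ externals ev then 1 else 0) + (if g = 0 then (Fintype.card K : ℤ) else 0) := by
  by_cases hg : g = 0
  · subst hg
    have : (0 : M) ∉ externals ev := by
      rw [externals, mem_filter, zeros_zero]
      omega
    rw [zeros_zero, hι]
    simp [this]
    ring
  · rcases h.zeros_eq hι hg with h0 | h0 <;> simp [externals, h0, hg]

/-- Total the zeros over the space: (q + 2) q^2 form by form, and 2 q^3 - 2 E + q element by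
element, where E is the number of externals. -/
theorem IsMDS.card_externals (h : IsMDS ev) (hι : Fintype.card ι = Fintype.card K + 2) :
    2 * (#(externals ev) : ℤ) = Fintype.card K * (Fintype.card K - 1) ^ 2 := by
  have hK : 1 ≤ Fintype.card K := Fintype.card_pos
  have key : ∑ g : M, zeros ev g = (Fintype.card K + 2) * Fintype.card K ^ 2 := by
    simp only [zeros]
    rw [← hι]
    have := sum_card_bipartiteAbove_eq_sum_card_bipartiteBelow (s := (univ : Finset M))
      (t := (univ : Finset ι)) (fun g i => ev i g = 0)
    simp only [bipartiteAbove, bipartiteBelow] at this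
    rw [this]
    simp_rw [h.card_fiber (by omega)]
    simp
  have key' : ∑ g : M, (zeros ev g : ℤ) = (Fintype.card K + 2) * Fintype.card K ^ 2 := by
    exact_mod_cast key
  simp_rw [h.zeros_eq_ite hι] at key'
  rw [sum_add_distrib, sum_sub_distrib, ← mul_sum, sum_boole, sum_ite_eq' univ (0 : M)] at key'
  simp only [sum_const, card_univ, h.card_eq (by omega : 2 < Fintype.card ι), mem_univ, if_true,
    filter_mem_eq_inter, univ_inter, nsmul_eq_mul] at key'
  push_cast at key'
  linarith

/-- Any two members of `F` have a common value at some form. -/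
def Agreeing (ev : ι → M →ₗ[K] K) (F : Finset M) : Prop :=
  ∀ g ∈ F, ∀ h ∈ F, ∃ i, ev i g = ev i h

/-- If g + a e = h + b e, evaluate at a form where g and h agree: since e does not vanish there, a =
b. -/
theorem Agreeing.injOn {F : Finset M} (hF : Agreeing ev F) {e : M} (he : e ∈ externals ev) :
    Set.InjOn (fun p : M × K => p.1 + p.2 • e) (F ×ˢ (univ : Finset K) : Finset (M × K)) := by
  rintro ⟨g, a⟩ hg ⟨h, b⟩ hh heq
  simp only [coe_product, Set.mem_prod, mem_coe, mem_univ, and_true] at hg hh heq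
  obtain ⟨i, hi⟩ := hF g hg h hh
  have h1 := congrArg (ev i) heq
  simp only [map_add, map_smul, smul_eq_mul, hi, add_right_inj] at h1
  have hab := mul_right_cancel₀ (mem_externals.1 he i) h1
  subst hab
  simpa using heq

theorem IsMDS.exists_external (h : IsMDS ev) (hι : Fintype.card ι = Fintype.card K + 2) :
    (externals ev).Nonempty := by
  have hK : 1 < Fintype.card K := Fintype.one_lt_card
  rw [← card_pos]
  have := h.card_externals hι
  have h2 : (0 : ℤ) < Fintype.card K * (Fintype.card K - 1) ^ 2 := by
    have : (1 : ℤ) < Fintype.card K := by exact_mod_cast hK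
    have : (0 : ℤ) < Fintype.card K - 1 := by linarith
    positivity
  omega

theorem IsMDS.card_le (h : IsMDS ev) (hι : Fintype.card ι = Fintype.card K + 2) {F : Finset M}
    (hF : Agreeing ev F) : #F ≤ Fintype.card K ^ 2 := by
  obtain ⟨e, he⟩ := h.exists_external hι
  have hM := h.card_eq (show 2 < Fintype.card ι by have := Fintype.card_pos (α := K); omega)
  have := card_le_univ ((F ×ˢ (univ : Finset K)).image fun p : M × K => p.1 + p.2 • e)
  rw [card_image_of_injOn (hF.injOn he), card_product, card_univ, hM, pow_succ] at this
  exact Nat.le_of_mul_le_mul_right this Fintype.card_pos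

/-- Equality in the bound makes the translates of F by the multiples of e a partition of the space.
-/
theorem IsMDS.card_line_inter (h : IsMDS ev) (hι : Fintype.card ι = Fintype.card K + 2)
    {F : Finset M} (hF : Agreeing ev F) (hc : #F = Fintype.card K ^ 2) {e : M}
    (he : e ∈ externals ev) (g : M) : #{c : K | g + c • e ∈ F} = 1 := by
  have hM := h.card_eq (show 2 < Fintype.card ι by have := Fintype.card_pos (α := K); omega)
  have himg : (F ×ˢ (univ : Finset K)).image (fun p : M × K => p.1 + p.2 • e) = univ := by
    rw [← card_eq_iff_eq_univ, card_image_of_injOn (hF.injOn he), card_product, card_univ,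
      hM, pow_succ, hc]
  have hg := mem_univ g
  rw [← himg, mem_image] at hg
  obtain ⟨⟨f, a⟩, hfa, hfa'⟩ := hg
  simp only [mem_product, mem_univ, and_true] at hfa hfa'
  rw [card_eq_one]
  refine ⟨-a, ?_⟩
  ext c
  simp only [mem_filter, mem_univ, true_and, mem_singleton]
  constructor
  · intro hcF
    have := hF.injOn he (x₁ := (g + c • e, -c)) (x₂ := (f, a)) (by simpa using hcF)
      (by simpa using hfa) (by simp [hfa', add_assoc])
    simp only [Prod.mk.injEq] at this
    rw [← this.2, neg_neg]
  · rintro rfl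
    simpa [← hfa'] using hfa

/-- Each external direction e leads from g to exactly one member g + c e of F, and each such member
is reached from q - 1 multiples of one direction. -/
theorem IsMDS.card_external_neighbours (h : IsMDS ev) (hι : Fintype.card ι = Fintype.card K + 2)
    {F : Finset M} (hF : Agreeing ev F) (hc : #F = Fintype.card K ^ 2) {g : M} (hg : g ∉ F) :
    2 * (#{f ∈ F | f - g ∈ externals ev} : ℤ) = Fintype.card K * (Fintype.card K - 1) := by
  have hK : 1 < Fintype.card K := Fintype.one_lt_card
  have key : #(externals ev) = (Fintype.card K - 1) * #{f ∈ F | f - g ∈ externals ev} := by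
    calc #(externals ev) = ∑ e ∈ externals ev, #{c : K | g + c • e ∈ F} := by
          rw [sum_congr rfl fun e he => h.card_line_inter hι hF hc he g]
          simp
      _ = ∑ c : K, #{e ∈ externals ev | g + c • e ∈ F} :=
          sum_card_bipartiteAbove_eq_sum_card_bipartiteBelow fun e (c : K) => g + c • e ∈ F
      _ = ∑ c ∈ univ.erase (0 : K), #{f ∈ F | f - g ∈ externals ev} := by
          -- The scalar 0 contributes nothing because g is not in F; every other scalar gives the
          -- same count, since externals are closed under nonzero scaling.
          rw [← add_sum_erase univ _ (mem_univ (0 : K))]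
          have : #{e ∈ externals ev | g + (0 : K) • e ∈ F} = 0 := by simp [hg]
          rw [this, zero_add]
          refine sum_congr rfl fun c hc' => ?_
          have hc0 : c ≠ 0 := ne_of_mem_erase hc'
          refine card_nbij' (fun e => g + c • e) (fun f => c⁻¹ • (f - g)) ?_ ?_ ?_ ?_
          · intro e he
            simp only [coe_filter, Set.mem_ofPred_eq] at he ⊢
            simpa [smul_mem_externals hc0] using he.symm
          · intro f hf
            simp only [coe_filter, Set.mem_ofPred_eq] at hf ⊢
            simpa [smul_mem_externals (inv_ne_zero hc0), smul_smul, hc0] using hf.symm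
          · intro e _
            simp [smul_smul, hc0]
          · intro f _
            simp [smul_smul, hc0]
      _ = _ := by simp [card_erase_of_mem]
  have h2 := h.card_externals hι
  obtain ⟨q, hq⟩ := Nat.exists_eq_add_of_le' hK.le
  rw [key, hq] at h2
  rw [hq]
  simp only [Nat.add_sub_cancel, Nat.cast_mul, Nat.cast_add, Nat.cast_one, add_sub_cancel_right]
    at h2 ⊢
  have hq0 : (q : ℤ) ≠ 0 := by
    have : q ≠ 0 := by omega
    exact_mod_cast this
  apply mul_left_cancel₀ hq0
  linear_combination h2

/-- The number of members of `F` taking the value `t` at the form `i`. -/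
def valueCount (ev : ι → M →ₗ[K] K) (F : Finset M) (i : ι) (t : K) : ℤ := #{f ∈ F | ev i f = t}

theorem sum_valueCount (F : Finset M) (i : ι) : ∑ t, valueCount ev F i t = #F := by
  simp only [valueCount]
  rw [card_eq_sum_card_fiberwise (f := ev i) (t := univ) (fun _ _ => by simp)]
  push_cast
  rfl

theorem sum_valueCount_sq (F : Finset M) (i : ι) :
    ∑ t, valueCount ev F i t ^ 2 = ∑ f ∈ F, valueCount ev F i (ev i f) := by
  rw [← sum_fiberwise']
  simp [valueCount, sq]

theorem sum_valueCount_apply (F : Finset M) (s : Finset ι) (g : M) :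
    ∑ i ∈ s, valueCount ev F i (ev i g) = ∑ f ∈ F, (#{i ∈ s | ev i (f - g) = 0} : ℤ) := by
  simp only [valueCount, map_sub, sub_eq_zero]
  exact_mod_cast sum_card_bipartiteAbove_eq_sum_card_bipartiteBelow fun i f => ev i f = ev i g

/-- The left side totals the zeros of f - g over f in F. It depends only on the number of external
differences, which is 0 for g in F and q(q - 1)/2 otherwise. -/
theorem IsMDS.sum_valueCount_eq (h : IsMDS ev) (hι : Fintype.card ι = Fintype.card K + 2)
    {F : Finset M} (hF : Agreeing ev F) (hc : #F = Fintype.card K ^ 2) (g : M) :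
    ∑ i, valueCount ev F i (ev i g) =
      Fintype.card K ^ 2 + Fintype.card K + (if g ∈ F then (Fintype.card K : ℤ) ^ 2 else 0) := by
  rw [sum_valueCount_apply]
  have : ∀ f ∈ F, (#{i | ev i (f - g) = 0} : ℤ) = zeros ev (f - g) := fun _ _ => rfl
  rw [sum_congr rfl this]
  simp_rw [h.zeros_eq_ite hι, sub_eq_zero]
  rw [sum_add_distrib, sum_sub_distrib, ← mul_sum, sum_boole, sum_ite_eq' F g]
  simp only [sum_const, hc, nsmul_eq_mul]
  split_ifs with hg
  · have : #{f ∈ F | f - g ∈ externals ev} = 0 := by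
      rw [card_eq_zero, filter_eq_empty_iff]
      intro f hf hfe
      obtain ⟨i, hi⟩ := hF f hf g hg
      exact mem_externals.1 hfe i (by simp [hi])
    rw [this]
    push_cast
    ring
  · rw [h.card_external_neighbours hι hF hc hg]
    push_cast
    ring

/-- Sum `IsMDS.sum_valueCount_eq` over the q elements with values s at i and t at j. Each of the q
other forms takes every value once there and contributes |F| = q^2, a constant. -/
theorem IsMDS.valueCount_add (h : IsMDS ev) (hι : Fintype.card ι = Fintype.card K + 2)
    {F : Finset M} (hF : Agreeing ev F) (hc : #F = Fintype.card K ^ 2) {i j : ι} (hij : i ≠ j)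
    (s t : K) : valueCount ev F i s + valueCount ev F j t =
      Fintype.card K + Fintype.card K * #{f ∈ F | ev i f = s ∧ ev j f = t} := by
  have hK : 1 < Fintype.card K := Fintype.one_lt_card
  have hsum := sum_congr (s₁ := ({g | ev i g = s ∧ ev j g = t} : Finset M)) rfl
    fun g _ => h.sum_valueCount_eq hι hF hc g
  rw [sum_comm, sum_add_distrib, sum_ite, sum_const_zero, add_zero, sum_const, sum_const,
    h.card_fiber_two (by omega) hij, filter_filter, ← add_sum_erase _ _ (mem_univ i),
    ← add_sum_erase (univ.erase i) _ (mem_erase.2 ⟨hij.symm, mem_univ j⟩)] at hsum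
  have h1 : ∑ g : M with ev i g = s ∧ ev j g = t, valueCount ev F i (ev i g)
      = Fintype.card K * valueCount ev F i s := by
    rw [sum_congr rfl (g := fun _ => valueCount ev F i s), sum_const,
      h.card_fiber_two (by omega) hij, nsmul_eq_mul]
    intro g hg
    rw [(mem_filter.1 hg).2.1]
  have h2 : ∑ g : M with ev i g = s ∧ ev j g = t, valueCount ev F j (ev j g)
      = Fintype.card K * valueCount ev F j t := by
    rw [sum_congr rfl (g := fun _ => valueCount ev F j t), sum_const,
      h.card_fiber_two (by omega) hij, nsmul_eq_mul]
    intro g hg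
    rw [(mem_filter.1 hg).2.2]
  have h3 : ∑ k ∈ (univ.erase i).erase j,
      ∑ g : M with ev i g = s ∧ ev j g = t, valueCount ev F k (ev k g)
      = (Fintype.card K : ℤ) * Fintype.card K ^ 2 := by
    rw [sum_congr rfl (g := fun _ => (Fintype.card K : ℤ) ^ 2), sum_const,
      card_erase_of_mem (mem_erase.2 ⟨hij.symm, mem_univ j⟩), card_erase_of_mem (mem_univ i),
      card_univ, hι, nsmul_eq_mul]
    · simp
    intro k hk
    simp only [mem_erase, mem_univ, and_true] at hk
    rw [h.sum_fiber_two hij hk.2.symm hk.1.symm, sum_valueCount, hc]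
    push_cast
    rfl
  have h4 : ({g | (ev i g = s ∧ ev j g = t) ∧ g ∈ F} : Finset M)
      = {f ∈ F | ev i f = s ∧ ev j f = t} := by
    ext g
    simp [and_comm]
  rw [h1, h2, h3, h4] at hsum
  have hq0 : (Fintype.card K : ℤ) ≠ 0 := by exact_mod_cast (by omega : Fintype.card K ≠ 0)
  apply mul_left_cancel₀ hq0
  simp only [nsmul_eq_mul] at hsum
  linear_combination hsum

/-- The sum counts ordered pairs in the slice with a further form where they agree. Two distinct
elements that agree at i agree at exactly one other form; an element agrees with itself at all q + 1
others. -/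
theorem IsMDS.sum_slice_sq (h : IsMDS ev) (hι : Fintype.card ι = Fintype.card K + 2)
    (F : Finset M) (i : ι) (s : K) :
    ∑ j ∈ univ.erase i, ∑ t, (#{f ∈ F | ev i f = s ∧ ev j f = t} : ℤ) ^ 2 =
      valueCount ev F i s ^ 2 + Fintype.card K * valueCount ev F i s := by
  have h1 : ∀ j t, (#{f ∈ F | ev i f = s ∧ ev j f = t} : ℤ)
      = valueCount ev {f ∈ F | ev i f = s} j t := fun j t => by
    rw [valueCount, filter_filter]
  simp_rw [h1, sum_valueCount_sq]
  rw [sum_comm]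
  simp_rw [sum_valueCount_apply]
  have h2 : ∀ g ∈ {f ∈ F | ev i f = s}, ∀ f ∈ {f ∈ F | ev i f = s},
      (#{j ∈ univ.erase i | ev j (f - g) = 0} : ℤ) =
        1 + if f = g then (Fintype.card K : ℤ) else 0 := by
    intro g hg f hf
    rw [mem_filter] at hg hf
    have hz : ev i (f - g) = 0 := by rw [map_sub, hf.2, hg.2, sub_self]
    have h3 := card_zeros_erase hz
    have h4 := h.zeros_eq_ite hι (f - g)
    have h5 : f - g ∉ externals ev := fun he => mem_externals.1 he i hz
    rw [← h3] at h4
    simp only [h5, if_false, sub_eq_zero] at h4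
    push_cast at h4
    linarith
  rw [sum_congr rfl fun g hg => sum_congr rfl (h2 g hg)]
  simp_rw [sum_add_distrib, sum_ite_eq']
  rw [sum_ite_mem, inter_self]
  simp only [sum_const, nsmul_eq_mul, mul_one, valueCount]
  ring

/-- Two values of the same form are taken equally often, or `q ^ 2` times altogether. -/
theorem IsMDS.valueCount_eq_or (h : IsMDS ev) (hι : Fintype.card ι = Fintype.card K + 2)
    {F : Finset M} (hF : Agreeing ev F) (hc : #F = Fintype.card K ^ 2) (i : ι) (s s' : K) :
    valueCount ev F i s = valueCount ev F i s' ∨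
      valueCount ev F i s + valueCount ev F i s' = Fintype.card K ^ 2 := by
  have hK : 1 < Fintype.card K := Fintype.one_lt_card
  have hq0 : (Fintype.card K : ℤ) ≠ 0 := by exact_mod_cast (by omega : Fintype.card K ≠ 0)
  -- Substituting `IsMDS.valueCount_add` into `IsMDS.sum_slice_sq` gives a quadratic equation for
  -- the count at s whose right side is independent of s.
  have key : ∀ s, (Fintype.card K : ℤ) *
      (valueCount ev F i s ^ 2 - Fintype.card K ^ 2 * valueCount ev F i s) =
      (Fintype.card K + 1) * Fintype.card K ^ 3 -
        ∑ j ∈ univ.erase i, ∑ t, valueCount ev F j t ^ 2 := by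
    intro s
    have h1 := congrArg (fun x => (Fintype.card K : ℤ) ^ 2 * x) (h.sum_slice_sq hι F i s)
    simp only [mul_sum, ← mul_pow] at h1
    have h2 : ∀ j ∈ univ.erase i,
        ∑ t, ((Fintype.card K : ℤ) * #{f ∈ F | ev i f = s ∧ ev j f = t}) ^ 2 =
        Fintype.card K * (valueCount ev F i s ^ 2 - Fintype.card K ^ 2) +
          ∑ t, valueCount ev F j t ^ 2 := by
      intro j hj
      have h3 : ∀ t, ((Fintype.card K : ℤ) * #{f ∈ F | ev i f = s ∧ ev j f = t}) ^ 2 =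
          (valueCount ev F i s - Fintype.card K) ^ 2 +
            2 * (valueCount ev F i s - Fintype.card K) * valueCount ev F j t +
            valueCount ev F j t ^ 2 := fun t => by
        have := h.valueCount_add hι hF hc (ne_of_mem_erase hj).symm s t
        rw [eq_sub_of_add_eq' this.symm]
        ring
      simp_rw [h3]
      rw [sum_add_distrib, sum_add_distrib, ← mul_sum, sum_valueCount, sum_const, card_univ,
        nsmul_eq_mul, hc]
      push_cast
      ring
    rw [sum_congr rfl h2, sum_add_distrib, sum_const, card_erase_of_mem (mem_univ i), card_univ,
      hι, nsmul_eq_mul] at h1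
    simp only [Nat.add_succ_sub_one] at h1
    push_cast at h1
    linear_combination h1
  have h1 := mul_left_cancel₀ hq0 ((key s).trans (key s').symm)
  have h2 : (valueCount ev F i s - valueCount ev F i s') *
      (valueCount ev F i s + valueCount ev F i s' - Fintype.card K ^ 2) = 0 := by
    linear_combination h1
  rcases mul_eq_zero.1 h2 with h3 | h3
  · left; linarith
  · right; linarith

theorem IsMDS.eq_fiber_of_card_eq (h : IsMDS ev) (hι : Fintype.card ι = Fintype.card K + 2)
    (hK : 2 < Fintype.card K) {F : Finset M} (hF : Agreeing ev F)
    (hc : #F = Fintype.card K ^ 2) : ∃ i t, F = ({g | ev i g = t} : Finset M) := by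
  have hq : (2 : ℤ) < Fintype.card K := by exact_mod_cast hK
  suffices ∃ i t, valueCount ev F i t = Fintype.card K ^ 2 by
    obtain ⟨i, t, hit⟩ := this
    refine ⟨i, t, ?_⟩
    have h1 : {f ∈ F | ev i f = t} = F := by
      apply eq_of_subset_of_card_le (filter_subset _ _)
      rw [hc]
      rw [valueCount] at hit
      exact_mod_cast hit.ge
    apply eq_of_subset_of_card_le
    · intro f hf
      rw [← h1, mem_filter] at hf
      simp [hf.2]
    · rw [h.card_fiber (by omega), hc]
  have hnonneg : ∀ i t, 0 ≤ valueCount ev F i t := fun i t => by simp [valueCount]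
  have hsum : ∀ i, ∑ t, valueCount ev F i t = (Fintype.card K : ℤ) ^ 2 := fun i => by
    rw [sum_valueCount, hc]
    push_cast
    rfl
  by_cases hconst : ∀ i s s', valueCount ev F i s = valueCount ev F i s'
  -- If every form took its values equally often, all counts would be q. A member of F would then
  -- see the total q(q + 2) instead of 2 q^2 + q.
  · exfalso
    obtain ⟨g, hg⟩ : F.Nonempty := by
      rw [← card_pos, hc]
      positivity
    have h1 : ∀ i, valueCount ev F i (ev i g) = Fintype.card K := fun i => by
      have := hsum i
      rw [sum_congr rfl fun s _ => hconst i s (ev i g), sum_const, card_univ, nsmul_eq_mul, sq]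
        at this
      exact mul_left_cancel₀ (by linarith) this
    have h2 := h.sum_valueCount_eq hι hF hc g
    simp_rw [h1] at h2
    rw [sum_const, card_univ, hι, if_pos hg, nsmul_eq_mul] at h2
    push_cast at h2
    nlinarith
  · push Not at hconst
    obtain ⟨i, s, s', hss⟩ := hconst
    have h1 := (h.valueCount_eq_or hι hF hc i s s').resolve_left hss
    have hs : s ≠ s' := fun e => hss (by rw [e])
    -- The values s and s' already account for all of F, so a third value u, which exists because q
    -- > 2, is never taken. Comparing s with u makes the count at s either 0 or q^2.
    obtain ⟨u, hu, hu'⟩ := exists_ne_ne hK s s'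
    have h2 : valueCount ev F i s + (valueCount ev F i s' + valueCount ev F i u)
        ≤ ∑ t, valueCount ev F i t := by
      rw [← add_sum_erase _ _ (mem_univ s),
        ← add_sum_erase (univ.erase s) _ (mem_erase.2 ⟨hs.symm, mem_univ s'⟩),
        ← add_sum_erase ((univ.erase s).erase s') _
          (mem_erase.2 ⟨hu'.symm, mem_erase.2 ⟨hu.symm, mem_univ u⟩⟩)]
      have := sum_nonneg fun t (_ : t ∈ ((univ.erase s).erase s').erase u) => hnonneg i t
      linarith
    rw [hsum] at h2
    have h3 : valueCount ev F i u = 0 := by linarith [hnonneg i u]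
    refine ⟨i, ?_⟩
    rcases h.valueCount_eq_or hι hF hc i s u with h4 | h4
    · exact ⟨s', by linarith⟩
    · exact ⟨s, by linarith⟩

end Family

end CircleGeometry

namespace CircleGeometry

open Finset

/-! ### Ovals in planes of even order: tangents and the nucleus. -/

section Arc

variable {K W ι : Type*} [Field K] [AddCommGroup W] [Module K W]

/-- A family of vectors any three of which are linearly independent. -/
def IsArc (w : ι → W) : Prop :=
  ∀ i j k, i ≠ j → i ≠ k → j ≠ k →
    ∀ a b c : K, a • w i + b • w j + c • w k = 0 → a = 0 ∧ b = 0 ∧ c = 0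

variable (K) in
/-- The evaluations of functionals at the members of a family of vectors. -/
def evalAt (w : ι → W) (i : ι) : Module.Dual K W →ₗ[K] K := Module.Dual.eval K W (w i)

theorem evalAt_apply (w : ι → W) (i : ι) (g : Module.Dual K W) : evalAt K w i g = g (w i) := rfl

theorem IsArc.isMDS {w : ι → W} (hw : IsArc (K := K) w) (hW : Module.finrank K W = 3) :
    IsMDS (evalAt K w) := by
  intro i j k hij hik hjk
  have hli : LinearIndependent K ![w i, w j, w k] := by
    rw [Fintype.linearIndependent_iff]
    intro c hc
    simp only [Fin.sum_univ_three, Matrix.cons_val_zero, Matrix.cons_val_one,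
      Matrix.cons_val] at hc
    obtain ⟨h0, h1, h2⟩ := hw i j k hij hik hjk _ _ _ hc
    intro m
    fin_cases m <;> assumption
  let b := basisOfLinearIndependentOfCardEqFinrank hli (by simp [hW])
  have hb : ⇑b = ![w i, w j, w k] := coe_basisOfLinearIndependentOfCardEqFinrank hli _
  have h0 : b 0 = w i := by rw [hb]; rfl
  have h1 : b 1 = w j := by rw [hb]; rfl
  have h2 : b 2 = w k := by rw [hb]; rfl
  constructor
  · intro g h hgh
    simp only [evalAt_apply, Prod.mk.injEq] at hgh
    refine b.ext fun m => ?_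
    fin_cases m
    · simpa [h0] using hgh.1
    · simpa [h1] using hgh.2.1
    · simpa [h2] using hgh.2.2
  · rintro ⟨s, t, u⟩
    refine ⟨b.constr K ![s, t, u], ?_⟩
    simp only [evalAt_apply, ← h0, ← h1, ← h2, Module.Basis.constr_basis]
    rfl

variable [Fintype K] [DecidableEq K] [Fintype (Module.Dual K W)]
  [DecidableEq (Module.Dual K W)] [Fintype ι] [DecidableEq ι]

theorem card_functionals_vanishing (hW : Module.finrank K W = 3) {u v : W}
    (huv : LinearIndependent K ![u, v]) :
    #{g : Module.Dual K W | g u = 0 ∧ g v = 0} = Fintype.card K := by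
  have : Module.Finite K W := Module.finite_of_finrank_eq_succ hW
  have h1 : Module.finrank K (Submodule.span K {u, v}) = 2 := by
    rw [← Matrix.range_cons_cons_empty u v ![], finrank_span_eq_card huv, Fintype.card_fin]
  have h2 := Subspace.finrank_add_finrank_dualAnnihilator_eq (Submodule.span K {u, v})
  have h3 : Module.finrank K (Submodule.span K {u, v}).dualAnnihilator = 1 := by omega
  have h4 := Module.natCard_eq_pow_finrank (K := K) (V := (Submodule.span K {u, v}).dualAnnihilator)
  rw [h3, pow_one, Nat.card_eq_fintype_card (α := K)] at h4
  rw [← h4]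
  refine (Nat.subtype_card _ ?_).symm
  intro g
  simp only [mem_filter, mem_univ, true_and, Submodule.mem_dualAnnihilator]
  constructor
  · rintro ⟨hu, hv⟩ x hx
    obtain ⟨a, b, rfl⟩ := Submodule.mem_span_pair.1 hx
    simp [hu, hv]
  · intro h
    exact ⟨h u (Submodule.subset_span (by simp)), h v (Submodule.subset_span (by simp))⟩

variable {w : ι → W}

/-- Every point off an oval in a plane of even order lies on a tangent line of the oval. -/
theorem IsArc.exists_tangent (hw : IsArc (K := K) w) (hW : Module.finrank K W = 3)
    (hι : Fintype.card ι = Fintype.card K + 1) (hq : Even (Fintype.card K)) {x : W}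
    (hx : ∀ i, LinearIndependent K ![x, w i]) :
    ∃ g : Module.Dual K W, g x = 0 ∧ zeros (evalAt K w) g = 1 := by
  have hM := hw.isMDS hW
  by_contra! hc
  -- Parity: the total (q + 1) q is even, while the zero functional alone contributes the odd number
  -- q + 1, so some other functional through x has an odd number of zeros.
  have h1 : ∑ g : Module.Dual K W with g x = 0, zeros (evalAt K w) g
      = (Fintype.card K + 1) * Fintype.card K := by
    have hswap := sum_card_bipartiteAbove_eq_sum_card_bipartiteBelow
      (s := ({g | g x = 0} : Finset (Module.Dual K W))) (t := (univ : Finset ι))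
      fun g i => evalAt K w i g = 0
    simp only [bipartiteAbove, bipartiteBelow, filter_filter] at hswap
    have hcard : ∀ i, #{g : Module.Dual K W | g x = 0 ∧ evalAt K w i g = 0} = Fintype.card K :=
      fun i => card_functionals_vanishing hW (hx i)
    simp only [zeros]
    rw [hswap]
    simp_rw [hcard]
    simp [hι]
  rw [← add_sum_erase _ _ (show (0 : Module.Dual K W) ∈ _ by simp), zeros_zero, hι] at h1
  have h2 : Even (∑ g ∈ ({g | g x = 0} : Finset (Module.Dual K W)).erase 0,
      zeros (evalAt K w) g) := by
    refine Finset.even_sum _ fun g hg => ?_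
    simp only [mem_erase, mem_filter, mem_univ, true_and] at hg
    have h3 := hM.zeros_le_two hg.1
    have h4 := hc g hg.2
    have : zeros (evalAt K w) g = 0 ∨ zeros (evalAt K w) g = 2 := by omega
    rcases this with h | h <;> simp [h]
  have h5 : Even ((Fintype.card K + 1) * Fintype.card K) := hq.mul_left _
  rw [← h1] at h5
  have h6 := (Nat.even_add.1 h5).2 h2
  exact Nat.not_even_iff_odd.2 hq.add_one h6

theorem IsArc.card_tangents (hw : IsArc (K := K) w) (hW : Module.finrank K W = 3)
    (hι : Fintype.card ι = Fintype.card K + 1) (i : ι) :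
    #{g | evalAt K w i g = 0 ∧ zeros (evalAt K w) g = 1} = Fintype.card K - 1 := by
  have hK : 1 < Fintype.card K := Fintype.one_lt_card
  have h1 := (hw.isMDS hW).card_tangent (by omega) i
  obtain ⟨q, hq⟩ := Nat.exists_eq_add_of_le' hK.le
  rw [hι, hq] at h1
  rw [hq]
  simp only [Nat.add_sub_cancel] at h1 ⊢
  nlinarith

theorem IsArc.linearIndependent_secant (hw : IsArc (K := K) w) (hι : 2 < Fintype.card ι) {i j : ι}
    (hij : i ≠ j) {c : K} (hc : c ≠ 0) (k : ι) : LinearIndependent K ![w i + c • w j, w k] := by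
  rw [LinearIndependent.pair_iff]
  intro s t hst
  by_cases hik : i = k
  · subst hik
    obtain ⟨l, hl, hl'⟩ := exists_ne_ne hι i j
    obtain ⟨h1, h2, -⟩ := hw i j l hij hl hl' (s + t) (s * c) 0 (by rw [← hst]; module)
    have hs : s = 0 := (mul_eq_zero.1 h2).resolve_right hc
    rw [hs, zero_add] at h1
    exact ⟨hs, h1⟩
  by_cases hjk : j = k
  · subst hjk
    obtain ⟨l, hl, hl'⟩ := exists_ne_ne hι i j
    obtain ⟨h1, h2, -⟩ := hw i j l hij hl hl' s (s * c + t) 0 (by rw [← hst]; module)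
    rw [h1, zero_mul, zero_add] at h2
    exact ⟨h1, h2⟩
  · obtain ⟨h1, -, h2⟩ := hw i j k hij hik hjk s (s * c) t (by rw [← hst]; module)
    exact ⟨h1, h2⟩

/-- Two tangent functionals vanishing at a common point of a secant are proportional. -/
theorem IsArc.tangent_proportional (hw : IsArc (K := K) w) (hW : Module.finrank K W = 3)
    (hι : Fintype.card ι = Fintype.card K + 1) (hq : Even (Fintype.card K)) {i j : ι}
    (hij : i ≠ j) {c : K} (hc : c ≠ 0) {g h : Module.Dual K W}
    (hg : zeros (evalAt K w) g = 1) (hh : zeros (evalAt K w) h = 1)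
    (hg0 : g (w i + c • w j) = 0) (hh0 : h (w i + c • w j) = 0) : ∃ a : K, h = a • g := by
  have hK : 1 < Fintype.card K := Fintype.one_lt_card
  have hι2 : 2 < Fintype.card ι := by omega
  set T : Finset (Module.Dual K W) := {g | zeros (evalAt K w) g = 1} with hT
  have hne : ∀ g ∈ T, g ≠ 0 := by
    rintro g hg rfl
    rw [hT, mem_filter, zeros_zero] at hg
    omega
  have hsmul : ∀ g ∈ T, ∀ a : K, a ≠ 0 → a • g ∈ T := by
    intro g hg a ha
    simpa [hT, zeros_smul ha] using hg
  have hcardT : (#T : ℤ) = (Fintype.card K + 1) * (Fintype.card K - 1) := by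
    have hswap := sum_card_bipartiteAbove_eq_sum_card_bipartiteBelow
      (s := T) (t := (univ : Finset ι)) fun g i => evalAt K w i g = 0
    simp only [bipartiteAbove, bipartiteBelow] at hswap
    have h1 : ∑ g ∈ T, #{i | evalAt K w i g = 0} = #T := by
      rw [card_eq_sum_ones]
      exact sum_congr rfl fun g hg => (mem_filter.1 hg).2
    have h2 : ∀ i, #{g ∈ T | evalAt K w i g = 0} = Fintype.card K - 1 := fun i => by
      rw [← hw.card_tangents hW hι i, hT, filter_filter]
      simp only [and_comm]
    rw [h1] at hswap
    simp_rw [h2] at hswap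
    rw [hswap, sum_const, card_univ, hι, smul_eq_mul]
    push_cast [Nat.cast_sub hK.le]
    ring
  have hlow : ∀ (g : Module.Dual K W) (x : W), g ∈ T → g x = 0 →
      ((univ.erase (0 : K)).image fun a => a • g) ⊆ {g ∈ T | g x = 0} ∧
      #((univ.erase (0 : K)).image fun a => a • g) = Fintype.card K - 1 := by
    intro g x hgT hgx
    constructor
    · intro h hh
      obtain ⟨a, ha, rfl⟩ := mem_image.1 hh
      rw [mem_filter]
      exact ⟨hsmul g hgT a (ne_of_mem_erase ha), by simp [hgx]⟩
    · rw [card_image_of_injective _ (smul_left_injective K (hne g hgT)),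
        card_erase_of_mem (mem_univ _), card_univ]
  -- Each of the q - 1 further points of the secant carries a tangent, hence at least its q - 1
  -- nonzero multiples.
  have hge : ∀ d ∈ univ.erase (0 : K),
      (Fintype.card K : ℤ) - 1 ≤ #{g ∈ T | g (w i + d • w j) = 0} := by
    intro d hd
    obtain ⟨g, hg1, hg2⟩ := hw.exists_tangent hW hι hq
      (hw.linearIndependent_secant hι2 hij (ne_of_mem_erase hd))
    obtain ⟨h1, h2⟩ := hlow g _ (by simp [hT, hg2]) hg1
    have := card_le_card h1
    omega
  -- There are q^2 - 1 tangent functionals, of which 2(q - 1) vanish at one end of the secant. Each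
  -- of the remaining (q - 1)^2 vanishes at exactly one further point, so every lower bound is
  -- attained.
  have hsum : ∑ d ∈ univ.erase (0 : K), (#{g ∈ T | g (w i + d • w j) = 0} : ℤ)
      = ∑ d ∈ univ.erase (0 : K), ((Fintype.card K : ℤ) - 1) := by
    have hswap := sum_card_bipartiteAbove_eq_sum_card_bipartiteBelow
      (s := T) (t := univ.erase (0 : K)) fun g d => g (w i + d • w j) = 0
    simp only [bipartiteAbove, bipartiteBelow] at hswap
    have h1 : ∀ g ∈ T, (#{d ∈ univ.erase (0 : K) | g (w i + d • w j) = 0} : ℤ)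
        = 1 - (if evalAt K w i g = 0 then 1 else 0) - if evalAt K w j g = 0 then 1 else 0 := by
      intro g hg
      obtain ⟨l, hl⟩ := card_eq_one.1 (mem_filter.1 hg).2
      have hl' : ∀ k, g (w k) = 0 ↔ k = l := fun k => by
        rw [← mem_singleton (a := l), ← hl, mem_filter]
        exact ⟨fun h => ⟨mem_univ _, h⟩, fun h => h.2⟩
      simp only [evalAt_apply, map_add, map_smul, smul_eq_mul]
      by_cases hi : g (w i) = 0
      · have hj : g (w j) ≠ 0 := fun hj => hij (((hl' i).1 hi).trans ((hl' j).1 hj).symm)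
        simp [hi, hj, filter_eq_empty_iff]
      by_cases hj : g (w j) = 0
      · simp [hi, hj]
      · simp only [hi, hj, if_false, sub_zero, Nat.cast_eq_one]
        rw [card_eq_one]
        refine ⟨-(g (w i) / g (w j)), ?_⟩
        ext d
        simp only [mem_filter, mem_erase, mem_univ, and_true, mem_singleton]
        constructor
        · rintro ⟨-, h⟩
          field_simp
          linear_combination h
        · rintro rfl
          refine ⟨neg_ne_zero.2 (div_ne_zero hi hj), ?_⟩
          field_simp
          ring
    have h2 : ∀ i, #{g ∈ T | evalAt K w i g = 0} = Fintype.card K - 1 := fun i => by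
      rw [← hw.card_tangents hW hι i, hT, filter_filter]
      simp only [and_comm]
    have hswap' : ∑ d ∈ univ.erase (0 : K), (#{g ∈ T | g (w i + d • w j) = 0} : ℤ)
        = ∑ g ∈ T, (#{d ∈ univ.erase (0 : K) | g (w i + d • w j) = 0} : ℤ) := by
      exact_mod_cast hswap.symm
    rw [hswap', sum_congr rfl h1, sum_sub_distrib, sum_sub_distrib, sum_boole, sum_boole, h2, h2,
      sum_const, sum_const, nsmul_eq_mul, nsmul_eq_mul, hcardT, card_erase_of_mem (mem_univ _),
      card_univ, Nat.cast_sub hK.le]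
    push_cast
    ring
  have heq := (sum_eq_sum_iff_of_le hge).1 hsum.symm c (by simp [hc])
  obtain ⟨h1, h2⟩ := hlow g (w i + c • w j) (by simp [hT, hg]) hg0
  have h3 := eq_of_subset_of_card_le h1 (by omega)
  have h4 : h ∈ {g ∈ T | g (w i + c • w j) = 0} :=
    mem_filter.2 ⟨mem_filter.2 ⟨mem_univ _, hh⟩, hh0⟩
  rw [← h3, mem_image] at h4
  obtain ⟨a, -, ha⟩ := h4
  exact ⟨a, ha.symm⟩

theorem exists_common_zero (hW : Module.finrank K W = 3) (g h : Module.Dual K W) :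
    ∃ x : W, x ≠ 0 ∧ g x = 0 ∧ h x = 0 := by
  have : Module.Finite K W := Module.finite_of_finrank_eq_succ hW
  have hlt : Module.finrank K (K × K) < Module.finrank K W := by simp [hW]
  obtain ⟨x, hx, hx0⟩ := Submodule.exists_mem_ne_zero_of_ne_bot
    (LinearMap.ker_ne_bot_of_finrank_lt (f := g.prod h) hlt)
  rw [LinearMap.mem_ker, LinearMap.prod_apply] at hx
  exact ⟨x, hx0, congrArg Prod.fst hx, congrArg Prod.snd hx⟩

/-- An oval in a plane of even order extends to a hyperoval. -/
theorem IsArc.exists_nucleus (hw : IsArc (K := K) w) (hW : Module.finrank K W = 3)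
    (hι : Fintype.card ι = Fintype.card K + 1) (hq : Even (Fintype.card K)) :
    ∃ n : W, IsArc (K := K) (fun o : Option ι => o.elim n w) := by
  have hK : 1 < Fintype.card K := Fintype.one_lt_card
  have hι2 : 2 < Fintype.card ι := by omega
  obtain ⟨k, l, hkl⟩ := Fintype.one_lt_card_iff.1 (show 1 < Fintype.card ι by omega)
  have htan : ∀ k, ∃ g, evalAt K w k g = 0 ∧ zeros (evalAt K w) g = 1 := fun k => by
    obtain ⟨g, hg⟩ := card_pos.1 (show 0 < #{g | evalAt K w k g = 0 ∧ zeros (evalAt K w) g = 1} by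
      rw [hw.card_tangents hW hι]; omega)
    exact ⟨g, (mem_filter.1 hg).2⟩
  obtain ⟨g, hgk, hg1⟩ := htan k
  obtain ⟨h, hhl, hh1⟩ := htan l
  obtain ⟨n, hn0, hgn, hhn⟩ := exists_common_zero hW g h
  have hunique : ∀ {g : Module.Dual K W} {i k}, zeros (evalAt K w) g = 1 → g (w k) = 0 →
      g (w i) = 0 → i = k := by
    intro g i k hg hk hi
    exact card_le_one.1 hg.le i (mem_filter.2 ⟨mem_univ _, hi⟩) k (mem_filter.2 ⟨mem_univ _, hk⟩)
  rw [evalAt_apply] at hgk hhl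
  have hnot : ∀ a : K, h ≠ a • g := by
    rintro a rfl
    have : a ≠ 0 := by
      rintro rfl
      rw [zero_smul, zeros_zero] at hh1
      omega
    have : g (w l) = 0 := by simpa [this] using hhl
    exact hkl (hunique hg1 hgk this).symm
  have hpoint : ∀ i (b : K), n ≠ b • w i := by
    intro i b hb
    have hb0 : b ≠ 0 := by
      rintro rfl
      exact hn0 (by simpa using hb)
    rw [hb] at hgn hhn
    have h1 : g (w i) = 0 := by simpa [hb0] using hgn
    have h2 : h (w i) = 0 := by simpa [hb0] using hhn
    exact hkl ((hunique hg1 hgk h1).symm.trans (hunique hh1 hhl h2))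
  -- The common point n of the tangents at k and l lies on no secant: otherwise two non-proportional
  -- tangents would pass through a point of that secant.
  have hind : ∀ i j, i ≠ j → ∀ a b c : K, a • n + b • w i + c • w j = 0 →
      a = 0 ∧ b = 0 ∧ c = 0 := by
    intro i j hij a b c habc
    by_cases ha : a = 0
    · obtain ⟨m, hm, hm'⟩ := exists_ne_ne hι2 i j
      obtain ⟨h1, h2, -⟩ := hw i j m hij hm hm' b c 0 (by rw [← habc, ha]; module)
      exact ⟨ha, h1, h2⟩
    exfalso
    have hn : n = (-(a⁻¹ * b)) • w i + (-(a⁻¹ * c)) • w j := by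
      have h1 : a • n = -(b • w i + c • w j) := by
        rw [eq_neg_iff_add_eq_zero, ← habc]
        module
      rw [← inv_smul_smul₀ ha n, h1]
      module
    by_cases hb : b = 0
    · exact hpoint j (-(a⁻¹ * c)) (by rw [hn, hb]; module)
    by_cases hc : c = 0
    · exact hpoint i (-(a⁻¹ * b)) (by rw [hn, hc]; module)
    have hn' : n = (-(a⁻¹ * b)) • (w i + (b⁻¹ * c) • w j) := by
      rw [hn, smul_add, smul_smul]
      congr 2
      field_simp
    have hab : -(a⁻¹ * b) ≠ 0 := neg_ne_zero.2 (mul_ne_zero (inv_ne_zero ha) hb)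
    rw [hn', map_smul, smul_eq_mul] at hgn hhn
    obtain ⟨d, hd⟩ := hw.tangent_proportional hW hι hq hij (mul_ne_zero (inv_ne_zero hb) hc) hg1 hh1
      ((mul_eq_zero.1 hgn).resolve_left hab) ((mul_eq_zero.1 hhn).resolve_left hab)
    exact hnot d hd
  refine ⟨n, ?_⟩
  rintro (_ | i) (_ | j) (_ | m) h1 h2 h3 a b c habc
  · exact absurd rfl h1
  · exact absurd rfl h1
  · exact absurd rfl h2
  · exact hind j m (fun e => h3 (by rw [e])) a b c habc
  · exact absurd rfl h3
  · obtain ⟨e1, e2, e3⟩ := hind i m (fun e => h2 (by rw [e])) b a c (by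
      rw [← habc]; simp only [Option.elim]; module)
    exact ⟨e2, e1, e3⟩
  · obtain ⟨e1, e2, e3⟩ := hind i j (fun e => h1 (by rw [e])) c a b (by
      rw [← habc]; simp only [Option.elim]; module)
    exact ⟨e2, e3, e1⟩
  · exact hw i j m (fun e => h1 (by rw [e])) (fun e => h2 (by rw [e])) (fun e => h3 (by rw [e]))
      a b c habc

end Arc

end CircleGeometry

namespace CircleGeometry

open Projectivization

/-! ### Coordinates on the cone: generators, vertex, and planes as graphs. -/

section Projective

variable {K V : Type*} [Field K] [AddCommGroup V] [Module K V]

theorem linearIndependent_triple_iff {x y z : V} : LinearIndependent K ![x, y, z] ↔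
    ∀ a b c : K, a • x + b • y + c • z = 0 → a = 0 ∧ b = 0 ∧ c = 0 := by
  rw [Fintype.linearIndependent_iff]
  simp only [Fin.sum_univ_three, Matrix.cons_val_zero, Matrix.cons_val_one, Matrix.cons_val]
  constructor
  · intro h a b c habc
    have := h ![a, b, c] (by simpa using habc)
    exact ⟨this 0, this 1, this 2⟩
  · intro h c hc m
    obtain ⟨h0, h1, h2⟩ := h _ _ _ hc
    fin_cases m <;> assumption

theorem isCollinear_triple_iff {x y z : V} (hx : x ≠ 0) (hy : y ≠ 0) (hz : z ≠ 0) :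
    IsCollinear ({mk K x hx, mk K y hy, mk K z hz} : Set (ℙ K V)) ↔
      ¬ LinearIndependent K ![x, y, z] := by
  constructor
  · rintro ⟨M, hfin, hM, hsub⟩ hli
    have hspan : Submodule.span K (Set.range ![x, y, z]) ≤ Subspace.submodule M := by
      rw [Submodule.span_le]
      rintro _ ⟨m, rfl⟩
      fin_cases m
      · exact (Subspace.mem_submodule_iff _ hx).2 (hsub (by simp))
      · exact (Subspace.mem_submodule_iff _ hy).2 (hsub (by simp))
      · exact (Subspace.mem_submodule_iff _ hz).2 (hsub (by simp))
    have h1 := Submodule.finrank_mono hspan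
    rw [finrank_span_eq_card hli, Fintype.card_fin] at h1
    omega
  · intro hli
    refine ⟨(Submodule.span K (Set.range ![x, y, z])).projectivization, ?_, ?_, ?_⟩
    · rw [Subspace.submodule.apply_symm_apply]
      exact Module.Finite.span_of_finite _ (Set.finite_range _)
    · rw [Subspace.submodule.apply_symm_apply]
      have h1 := finrank_range_le_card (R := K) ![x, y, z]
      rw [Fintype.card_fin] at h1
      have h2 := mt linearIndependent_iff_card_eq_finrank_span.2 hli
      rw [Fintype.card_fin] at h2
      exact Nat.le_of_lt_succ (lt_of_le_of_ne h1 (Ne.symm h2))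
    · rintro p (rfl | rfl | rfl)
      · exact Submodule.subset_span ⟨0, rfl⟩
      · exact Submodule.subset_span ⟨1, rfl⟩
      · exact Submodule.subset_span ⟨2, rfl⟩

theorem mk_mem_span_pair_iff {x y z : V} (hx : x ≠ 0) (hy : y ≠ 0) (hz : z ≠ 0) :
    mk K z hz ∈ Subspace.span ({mk K x hx, mk K y hy} : Set (ℙ K V)) ↔
      ∃ a b : K, a • x + b • y = z := by
  rw [← Submodule.mem_span_pair]
  constructor
  · intro h
    have hle : Subspace.span ({mk K x hx, mk K y hy} : Set (ℙ K V))
        ≤ (Submodule.span K {x, y}).projectivization := by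
      rw [Subspace.span_le_subspace_iff]
      rintro p (rfl | rfl)
      · exact Submodule.subset_span (by simp)
      · exact Submodule.subset_span (by simp)
    exact hle h
  · intro h
    rw [Subspace.mem_span]
    intro U hU
    rw [← Subspace.mem_submodule_iff _ hz]
    refine Submodule.span_le.2 ?_ h
    rintro v (rfl | rfl)
    · exact (Subspace.mem_submodule_iff _ hx).2 (hU (by simp))
    · exact (Subspace.mem_submodule_iff _ hy).2 (hU (by simp))

theorem IsLine.eq_span {l : Projectivization.Subspace K V} (hl : IsLine l) {x y : V}
    (hxy : LinearIndependent K ![x, y]) (hx : x ∈ Subspace.submodule l)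
    (hy : y ∈ Subspace.submodule l) : Subspace.submodule l = Submodule.span K {x, y} := by
  have : Module.Finite K (Subspace.submodule l) := Module.finite_of_finrank_eq_succ hl
  refine (Submodule.eq_of_le_of_finrank_eq ?_ ?_).symm
  · rw [Submodule.span_le]
    rintro v (rfl | rfl) <;> assumption
  · rw [← Matrix.range_cons_cons_empty x y ![], finrank_span_eq_card hxy, Fintype.card_fin, hl]

theorem isLine_span {x y : V} (hxy : LinearIndependent K ![x, y]) :
    IsLine (Submodule.span K {x, y}).projectivization := by
  rw [IsLine, Subspace.submodule.apply_symm_apply, ← Matrix.range_cons_cons_empty x y ![],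
    finrank_span_eq_card hxy, Fintype.card_fin]

/-- Coordinates for an oval cone in a three-space: a decomposition of the space into a plane and the
vertex, and a hyperoval of the plane consisting of a basis of the cone and its nucleus. -/
structure ConeFrame (Q : Set (ℙ K V)) (W ι : Type*) [AddCommGroup W] [Module K W] where
  /-- The decomposition into plane and vertex. -/
  chart : (W × K) ≃ₗ[K] V
  /-- Representatives of the points of the oval. -/
  gen : ι → W
  /-- A representative of the nucleus of the oval. -/
  nuc : W
  arc : IsArc (K := K) fun o : Option ι => o.elim nuc gen
  -- The scalar b = 0 is allowed and accounts for the vertex.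
  mem_iff : ∀ x t (h : chart (x, t) ≠ 0), mk K (chart (x, t)) h ∈ Q ↔ ∃ i, ∃ b : K, x = b • gen i
  finrank_plane : Module.finrank K W = 3
  card_index : Nat.card ι = Nat.card K + 1

namespace ConeFrame

variable {W ι : Type*} [AddCommGroup W] [Module K W] {Q : Set (ℙ K V)} (C : ConeFrame Q W ι)

include C

theorem arc_gen : IsArc (K := K) C.gen := fun i j k hij hik hjk a b c h =>
  C.arc (some i) (some j) (some k) (by simpa) (by simpa) (by simpa) a b c h

theorem arc_nuc {i j : ι} (hij : i ≠ j) (a b c : K)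
    (h : a • C.nuc + b • C.gen i + c • C.gen j = 0) : a = 0 ∧ b = 0 ∧ c = 0 :=
  C.arc none (some i) (some j) (by simp) (by simp) (by simpa) a b c h

variable [Finite K]

theorem finite_index : Finite ι := Nat.finite_of_card_ne_zero (by rw [C.card_index]; omega)

theorem exists_ne (i : ι) : ∃ j, i ≠ j := by
  have := C.finite_index
  have h1 : 0 < Nat.card K := Nat.card_pos
  have : Nontrivial ι := Finite.one_lt_card_iff_nontrivial.1 (by rw [C.card_index]; omega)
  obtain ⟨j, hj⟩ := _root_.exists_ne i
  exact ⟨j, hj.symm⟩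

theorem nonempty_index : Nonempty ι := by
  have := C.finite_index
  exact (Nat.card_pos_iff.1 (by rw [C.card_index]; omega)).1

theorem gen_pair {i j : ι} (hij : i ≠ j) (a b : K) (h : a • C.gen i + b • C.gen j = 0) :
    a = 0 ∧ b = 0 :=
  (C.arc_nuc hij 0 a b (by rw [zero_smul, zero_add, h])).2

theorem nuc_pair (i : ι) (a b : K) (h : a • C.nuc + b • C.gen i = 0) : a = 0 ∧ b = 0 := by
  obtain ⟨j, hij⟩ := C.exists_ne i
  obtain ⟨h1, h2, -⟩ := C.arc_nuc hij a b 0 (by rw [zero_smul, add_zero, h])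
  exact ⟨h1, h2⟩

theorem gen_ne_zero (i : ι) : C.gen i ≠ 0 := by
  intro h
  exact one_ne_zero (C.nuc_pair i (0 : K) 1 (by simp [h])).2

theorem nuc_ne_zero : C.nuc ≠ 0 := by
  obtain ⟨i⟩ := C.nonempty_index
  intro h
  exact one_ne_zero (C.nuc_pair i (1 : K) 0 (by simp [h])).1

theorem chart_ne_zero {x : W} (hx : x ≠ 0) (t : K) : C.chart (x, t) ≠ 0 := by
  simp [hx]

theorem chart_vertex_ne_zero : C.chart ((0 : W), (1 : K)) ≠ 0 := by
  simp

/-- The point of the space with coordinates `x` and `t`. -/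
def point (x : W) (hx : x ≠ 0) (t : K) : ℙ K V := Projectivization.mk K (C.chart (x, t)) (C.chart_ne_zero hx t)

/-- The vertex of the cone. -/
def vertex : ℙ K V := Projectivization.mk K (C.chart ((0 : W), (1 : K))) C.chart_vertex_ne_zero

/-- The points of the generator `i` other than the vertex. -/
def genPoint (i : ι) (t : K) : ℙ K V := C.point (C.gen i) (C.gen_ne_zero i) t

theorem eq_vertex_or_point (p : ℙ K V) : p = C.vertex ∨ ∃ x hx t, p = C.point x hx t := by
  induction p using Projectivization.ind with | h v hv =>
  obtain ⟨⟨x, t⟩, rfl⟩ := C.chart.surjective v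
  by_cases hx : x = 0
  · subst hx
    have ht : t ≠ 0 := by
      rintro rfl
      exact hv (by simp)
    left
    rw [vertex, mk_eq_mk_iff']
    exact ⟨t, by rw [← map_smul]; simp⟩
  · exact .inr ⟨x, hx, t, rfl⟩

theorem point_smul {x : W} (hx : x ≠ 0) (t : K) {b : K} (hb : b ≠ 0) :
    C.point (b • x) (smul_ne_zero hb hx) t = C.point x hx (b⁻¹ * t) := by
  rw [point, point, mk_eq_mk_iff']
  refine ⟨b, ?_⟩
  rw [← map_smul]
  simp [hb]

theorem point_eq_iff {x y : W} (hx : x ≠ 0) (hy : y ≠ 0) (s t : K) :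
    C.point x hx s = C.point y hy t ↔ ∃ a : K, a • y = x ∧ a * t = s := by
  rw [point, point, mk_eq_mk_iff']
  simp only [← map_smul, EmbeddingLike.apply_eq_iff_eq, Prod.smul_mk, Prod.mk.injEq, smul_eq_mul]

theorem genPoint_eq_iff {i j : ι} {s t : K} :
    C.genPoint i s = C.genPoint j t ↔ i = j ∧ s = t := by
  rw [genPoint, genPoint, point_eq_iff]
  constructor
  · rintro ⟨a, h1, h2⟩
    by_cases hij : i = j
    · subst hij
      have ha : a = 1 := by
        have h3 : (a - 1) • C.gen i = 0 := by rw [sub_smul, h1, one_smul, sub_self]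
        exact sub_eq_zero.1 ((smul_eq_zero.1 h3).resolve_right (C.gen_ne_zero i))
      rw [ha, one_mul] at h2
      exact ⟨rfl, h2.symm⟩
    · have := (C.gen_pair hij (-1) a (by rw [h1]; module)).1
      simp at this
  · rintro ⟨rfl, rfl⟩
    exact ⟨1, by simp, by simp⟩

theorem vertex_mem : C.vertex ∈ Q := by
  obtain ⟨i⟩ := C.nonempty_index
  exact (C.mem_iff _ _ _).2 ⟨i, 0, by simp⟩

theorem genPoint_mem (i : ι) (t : K) : C.genPoint i t ∈ Q :=
  (C.mem_iff _ _ _).2 ⟨i, 1, by simp⟩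

theorem vertex_ne_genPoint (i : ι) (t : K) : C.vertex ≠ C.genPoint i t := by
  intro h
  rw [vertex, genPoint, point, mk_eq_mk_iff'] at h
  obtain ⟨a, ha⟩ := h
  rw [← map_smul, EmbeddingLike.apply_eq_iff_eq, Prod.smul_mk, Prod.mk.injEq] at ha
  have := (smul_eq_zero.1 ha.1).resolve_right (C.gen_ne_zero i)
  simp [this] at ha

theorem eq_vertex_or_genPoint {p : ℙ K V} (hp : p ∈ Q) :
    p = C.vertex ∨ ∃ i t, p = C.genPoint i t := by
  rcases C.eq_vertex_or_point p with h | ⟨x, hx, t, rfl⟩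
  · exact .inl h
  · obtain ⟨i, b, rfl⟩ := (C.mem_iff _ _ _).1 hp
    have hb : b ≠ 0 := by
      rintro rfl
      exact hx (by simp)
    exact .inr ⟨i, _, C.point_smul (C.gen_ne_zero i) t hb⟩

theorem isSingularPoint_vertex : IsSingularPoint Q C.vertex := by
  refine ⟨C.vertex_mem, fun l hl hvl => ?_⟩
  by_cases h : ∃ i t, C.genPoint i t ∈ l
  · right
    obtain ⟨i, t, hit⟩ := h
    have hv := (Subspace.mem_submodule_iff _ C.chart_vertex_ne_zero).2 hvl
    have hg := (Subspace.mem_submodule_iff _ (C.chart_ne_zero (C.gen_ne_zero i) t)).2 hit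
    have hli : LinearIndependent K ![C.chart ((0 : W), (1 : K)), C.chart (C.gen i, t)] := by
      rw [LinearIndependent.pair_iff]
      intro a b hab
      rw [← map_smul, ← map_smul, ← map_add, map_eq_zero_iff _ C.chart.injective] at hab
      simp only [Prod.smul_mk, Prod.mk_add_mk, Prod.mk_eq_zero, smul_zero, zero_add,
        smul_eq_zero, C.gen_ne_zero i, or_false, smul_eq_mul, mul_one] at hab
      obtain ⟨rfl, h2⟩ := hab
      exact ⟨by simpa using h2, rfl⟩
    have hspan := hl.eq_span hli hv hg
    intro p hp
    induction p using Projectivization.ind with | h v hv =>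
    have hv' := (Subspace.mem_submodule_iff _ hv).2 hp
    rw [hspan, Submodule.mem_span_pair] at hv'
    obtain ⟨a, b, rfl⟩ := hv'
    have hchart : a • C.chart ((0 : W), (1 : K)) + b • C.chart (C.gen i, t)
        = C.chart (b • C.gen i, a + b * t) := by
      rw [← map_smul, ← map_smul, ← map_add]
      simp
    simp only [hchart]
    exact (C.mem_iff _ _ _).2 ⟨i, b, rfl⟩
  · left
    ext p
    simp only [Set.mem_inter_iff, SetLike.mem_coe, Set.mem_singleton_iff]
    constructor
    · rintro ⟨hpl, hpQ⟩
      rcases C.eq_vertex_or_genPoint hpQ with rfl | ⟨i, t, rfl⟩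
      · rfl
      · exact absurd ⟨i, t, hpl⟩ h
    · rintro rfl
      exact ⟨hvl, C.vertex_mem⟩

theorem not_isSingularPoint_genPoint (i : ι) (t : K) :
    ¬ IsSingularPoint Q (C.genPoint i t) := by
  rintro ⟨-, h⟩
  obtain ⟨j, hij⟩ := C.exists_ne i
  have hli : LinearIndependent K ![C.chart (C.gen i, t), C.chart (C.gen j, 0)] := by
    rw [LinearIndependent.pair_iff]
    intro a b hab
    rw [← map_smul, ← map_smul, ← map_add, map_eq_zero_iff _ C.chart.injective] at hab
    simp only [Prod.smul_mk, Prod.mk_add_mk, Prod.mk_eq_zero] at hab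
    exact C.gen_pair hij a b hab.1
  have hj : C.genPoint j 0 ∈ (Submodule.span K
      {C.chart (C.gen i, t), C.chart (C.gen j, 0)}).projectivization :=
    Submodule.subset_span (by simp)
  rcases h _ (isLine_span hli) (Submodule.subset_span (by simp)) with h1 | h1
  · have : C.genPoint j 0 ∈ ({C.genPoint i t} : Set (ℙ K V)) := by
      rw [← h1]
      exact ⟨hj, C.genPoint_mem j 0⟩
    exact hij (C.genPoint_eq_iff.1 this).1.symm
  -- The line joining points of two generators is not contained in the cone: the sum of the two oval
  -- vectors is a multiple of no oval vector.
  · have hne : C.gen i + C.gen j ≠ 0 := fun h0 =>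
      one_ne_zero (C.gen_pair hij (1 : K) 1 (by simpa using h0)).1
    have hsum : C.point (C.gen i + C.gen j) hne t ∈ Q := by
      apply h1
      refine Submodule.mem_span_pair.2 ⟨1, 1, ?_⟩
      rw [one_smul, one_smul, ← map_add]
      simp
    obtain ⟨k, b, hb⟩ := (C.mem_iff _ _ _).1 hsum
    by_cases hik : i = k
    · subst hik
      exact one_ne_zero (C.gen_pair hij (1 - b) 1 (by rw [sub_smul, ← hb]; module)).2
    by_cases hjk : j = k
    · subst hjk
      exact one_ne_zero (C.gen_pair hij 1 (1 - b) (by rw [sub_smul, ← hb]; module)).1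
    · exact one_ne_zero (C.arc_gen i j k hij hik hjk 1 1 (-b) (by rw [neg_smul, ← hb]; module)).1

theorem mem_points_iff {p : ℙ K V} :
    p ∈ points Q ↔ ∃ i t, p = C.genPoint i t := by
  constructor
  · rintro ⟨hp, hs⟩
    rcases C.eq_vertex_or_genPoint hp with rfl | h
    · exact absurd C.isSingularPoint_vertex hs
    · exact h
  · rintro ⟨i, t, rfl⟩
    exact ⟨C.genPoint_mem i t, C.not_isSingularPoint_genPoint i t⟩

/-- The isomorphism of `W` with the vector space underlying the plane of a functional. -/
def lift (g : Module.Dual K W) : W →ₗ[K] V := C.chart.toLinearMap ∘ₗ LinearMap.id.prod g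

omit [Finite K] in
theorem lift_apply (g : Module.Dual K W) (x : W) : C.lift g x = C.chart (x, g x) := rfl

omit [Finite K] in
theorem lift_injective (g : Module.Dual K W) : Function.Injective (C.lift g) := by
  intro x y h
  rw [lift_apply, lift_apply, EmbeddingLike.apply_eq_iff_eq, Prod.mk.injEq] at h
  exact h.1

/-- The plane not containing the vertex that is the graph of a functional. -/
def plane (g : Module.Dual K W) : Projectivization.Subspace K V :=
  (LinearMap.range (C.lift g)).projectivization

theorem submodule_plane (g : Module.Dual K W) :
    Subspace.submodule (C.plane g) = LinearMap.range (C.lift g) :=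
  Subspace.submodule.apply_symm_apply _

theorem isPlane_plane (g : Module.Dual K W) : IsPlane (C.plane g) := by
  rw [IsPlane, submodule_plane, LinearMap.finrank_range_of_inj (C.lift_injective g),
    C.finrank_plane]

theorem point_mem_plane_iff {g : Module.Dual K W} {x : W} (hx : x ≠ 0) {t : K} :
    C.point x hx t ∈ C.plane g ↔ g x = t := by
  rw [point, ← Subspace.mem_submodule_iff, submodule_plane, LinearMap.mem_range]
  simp only [lift_apply, EmbeddingLike.apply_eq_iff_eq, Prod.mk.injEq]
  constructor
  · rintro ⟨y, rfl, h⟩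
    exact h
  · exact fun h => ⟨x, rfl, h⟩

theorem vertex_not_mem_plane (g : Module.Dual K W) : C.vertex ∉ C.plane g := by
  rw [vertex, ← Subspace.mem_submodule_iff, submodule_plane, LinearMap.mem_range]
  simp only [lift_apply, EmbeddingLike.apply_eq_iff_eq, Prod.mk.injEq, not_exists]
  rintro y ⟨rfl, h⟩
  simp at h

/-- The section of the cone with the plane of a functional. -/
def circle (g : Module.Dual K W) : Set (ℙ K V) := Q ∩ C.plane g

theorem genPoint_mem_circle_iff {g : Module.Dual K W} {i : ι} {t : K} :
    C.genPoint i t ∈ C.circle g ↔ g (C.gen i) = t :=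
  ⟨fun h => (C.point_mem_plane_iff (C.gen_ne_zero i)).1 h.2,
    fun h => ⟨C.genPoint_mem i t, (C.point_mem_plane_iff (C.gen_ne_zero i)).2 h⟩⟩

theorem mem_circle_iff {g : Module.Dual K W} {p : ℙ K V} :
    p ∈ C.circle g ↔ ∃ i, p = C.genPoint i (g (C.gen i)) := by
  constructor
  · rintro hp
    rcases C.eq_vertex_or_genPoint hp.1 with rfl | ⟨i, t, rfl⟩
    · exact absurd hp.2 (C.vertex_not_mem_plane g)
    · exact ⟨i, by rw [C.genPoint_mem_circle_iff.1 hp]⟩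
  · rintro ⟨i, rfl⟩
    exact C.genPoint_mem_circle_iff.2 rfl

theorem genPoint_graph_injective (g : Module.Dual K W) :
    Function.Injective fun i => C.genPoint i (g (C.gen i)) :=
  fun _ _ h => (C.genPoint_eq_iff.1 h).1

theorem linearIndependent_lift (g : Module.Dual K W) {i j k : ι} (hij : i ≠ j) (hik : i ≠ k)
    (hjk : j ≠ k) :
    LinearIndependent K ![C.lift g (C.gen i), C.lift g (C.gen j), C.lift g (C.gen k)] := by
  rw [linearIndependent_triple_iff]
  intro a b c h
  rw [← map_smul, ← map_smul, ← map_smul, ← map_add, ← map_add,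
    map_eq_zero_iff _ (C.lift_injective g)] at h
  exact C.arc_gen i j k hij hik hjk a b c h

theorem isOvalOf_circle (g : Module.Dual K W) : IsOvalOf (C.plane g) (C.circle g) := by
  refine ⟨Set.inter_subset_right, ?_, ?_⟩
  · have : C.circle g = (fun i => C.genPoint i (g (C.gen i))) '' Set.univ := by
      ext p
      rw [mem_circle_iff]
      simp [eq_comm]
    rw [this, Set.ncard_image_of_injective _ (C.genPoint_graph_injective g), Set.ncard_univ,
      C.card_index]
  · intro a ha b hb c hc hab hac hbc
    rw [mem_circle_iff] at ha hb hc
    obtain ⟨i, rfl⟩ := ha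
    obtain ⟨j, rfl⟩ := hb
    obtain ⟨k, rfl⟩ := hc
    rw [genPoint, genPoint, genPoint, point, point, point, isCollinear_triple_iff, not_not]
    exact C.linearIndependent_lift g (fun e => hab (by rw [e])) (fun e => hac (by rw [e]))
      (fun e => hbc (by rw [e]))

theorem circle_mem_circles (g : Module.Dual K W) : C.circle g ∈ circles Q :=
  ⟨C.plane g, C.isPlane_plane g, C.isOvalOf_circle g, rfl⟩

/-- A plane through the vertex either contains a whole generator, hence three collinear points of
the cone, or meets the cone in the vertex alone. -/
theorem vertex_not_mem_of_isOvalOf {π : Projectivization.Subspace K V} (h : IsOvalOf π (Q ∩ π)) :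
    C.vertex ∉ π := by
  intro hv
  obtain ⟨-, hcard, hcol⟩ := h
  by_cases hg : ∃ i t, C.genPoint i t ∈ π
  · obtain ⟨i, t, hit⟩ := hg
    have hall : ∀ s, C.genPoint i s ∈ π := by
      intro s
      rw [genPoint, point, ← Subspace.mem_submodule_iff]
      have h1 := (Subspace.mem_submodule_iff _ C.chart_vertex_ne_zero).2 hv
      have h2 := (Subspace.mem_submodule_iff _ (C.chart_ne_zero (C.gen_ne_zero i) t)).2 hit
      have h3 : C.chart (C.gen i, s)
          = C.chart (C.gen i, t) + (s - t) • C.chart ((0 : W), (1 : K)) := by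
        rw [← map_smul, ← map_add]
        simp
      rw [h3]
      exact add_mem h2 (Submodule.smul_mem _ _ h1)
    refine hcol _ ⟨C.vertex_mem, hv⟩ _ ⟨C.genPoint_mem i 0, hall 0⟩ _ ⟨C.genPoint_mem i 1, hall 1⟩
      (C.vertex_ne_genPoint i 0) (C.vertex_ne_genPoint i 1)
      (fun e => zero_ne_one (C.genPoint_eq_iff.1 e).2) ?_
    rw [vertex, genPoint, genPoint, point, point, isCollinear_triple_iff,
      linearIndependent_triple_iff]
    intro hc
    have := (hc 1 1 (-1) (by
      rw [← map_smul, ← map_smul, ← map_smul, ← map_add, ← map_add,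
        map_eq_zero_iff _ C.chart.injective]
      simp)).1
    simp at this
  · have : Q ∩ π = {C.vertex} := by
      ext p
      simp only [Set.mem_inter_iff, SetLike.mem_coe, Set.mem_singleton_iff]
      constructor
      · rintro ⟨hpQ, hpl⟩
        rcases C.eq_vertex_or_genPoint hpQ with rfl | ⟨i, t, rfl⟩
        · rfl
        · exact absurd ⟨i, t, hpl⟩ hg
      · rintro rfl
        exact ⟨C.vertex_mem, hv⟩
    rw [this, Set.ncard_singleton] at hcard
    have : 0 < Nat.card K := Nat.card_pos
    omega

/-- Missing the vertex means that projection to W is injective on the plane; by dimension it is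
bijective, so the plane is a graph. -/
theorem exists_eq_plane {π : Projectivization.Subspace K V} (hπ : IsPlane π)
    (hv : C.vertex ∉ π) : ∃ g, π = C.plane g := by
  have hfin : Module.Finite K W := Module.finite_of_finrank_eq_succ C.finrank_plane
  set U : Submodule K (W × K) := (Subspace.submodule π).map C.chart.symm.toLinearMap with hU
  have hmem : ∀ y, y ∈ U ↔ C.chart y ∈ Subspace.submodule π := by
    intro y
    rw [hU, Submodule.mem_map]
    constructor
    · rintro ⟨v, hv, rfl⟩
      simpa using hv
    · exact fun h => ⟨_, h, by simp⟩
  have hUrank : Module.finrank K U = Module.finrank K W := by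
    rw [C.finrank_plane, ← hπ]
    exact LinearEquiv.finrank_map_eq C.chart.symm _
  have hinj : Function.Injective (LinearMap.fst K W K ∘ₗ U.subtype) := by
    rw [← LinearMap.ker_eq_bot, LinearMap.ker_eq_bot']
    rintro ⟨⟨x, t⟩, hxt⟩ hx
    have hx' : x = 0 := hx
    subst hx'
    rw [hmem] at hxt
    by_contra ht
    have ht' : t ≠ 0 := by
      rintro rfl
      exact ht rfl
    refine hv ?_
    rw [vertex, ← Subspace.mem_submodule_iff]
    have h1 : C.chart ((0 : W), (1 : K)) = t⁻¹ • C.chart (0, t) := by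
      rw [← map_smul]
      simp [ht']
    rw [h1]
    exact Submodule.smul_mem _ _ hxt
  have hsurj := (LinearMap.injective_iff_surjective_of_finrank_eq_finrank hUrank).1 hinj
  obtain ⟨g, hg⟩ := Submodule.exists_eq_graph (G := U) ⟨hinj, hsurj⟩
  refine ⟨g, ?_⟩
  apply Subspace.submodule.injective
  rw [submodule_plane]
  ext v
  obtain ⟨⟨x, t⟩, rfl⟩ := C.chart.surjective v
  rw [← hmem, hg, LinearMap.mem_graph_iff, LinearMap.mem_range]
  simp only [lift_apply, EmbeddingLike.apply_eq_iff_eq, Prod.mk.injEq]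
  constructor
  · intro h
    exact ⟨x, rfl, h.symm⟩
  · rintro ⟨y, rfl, h⟩
    exact h.symm

theorem mem_circles_iff {c : Set (ℙ K V)} : c ∈ circles Q ↔ ∃ g, c = C.circle g := by
  constructor
  · rintro ⟨π, hπ, ho, rfl⟩
    obtain ⟨g, rfl⟩ := C.exists_eq_plane hπ (C.vertex_not_mem_of_isOvalOf ho)
    exact ⟨g, rfl⟩
  · rintro ⟨g, rfl⟩
    exact C.circle_mem_circles g

end ConeFrame

end Projective

end CircleGeometry

namespace CircleGeometry

open Projectivization

namespace ConeFrame

variable {K V W ι : Type*} [Field K] [AddCommGroup V] [Module K V] [AddCommGroup W] [Module K W]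
  {Q : Set (ℙ K V)} (C : ConeFrame Q W ι)

/-- The oval together with its nucleus. -/
def hyper : Option ι → W := fun o => o.elim C.nuc C.gen

/-! ### Translation of circles, tangency and nuclei into functionals on the hyperoval. -/

section Counting

variable [Fintype K] [DecidableEq K] [Fintype (Module.Dual K W)] [DecidableEq (Module.Dual K W)]
  [Fintype ι] [DecidableEq ι]

include C

theorem fintype_card_index : Fintype.card ι = Fintype.card K + 1 := by
  rw [← Nat.card_eq_fintype_card, ← Nat.card_eq_fintype_card, C.card_index]

theorem card_hyper : Fintype.card (Option ι) = Fintype.card K + 2 := by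
  rw [Fintype.card_option, C.fintype_card_index]

theorem isMDS_gen : IsMDS (evalAt K C.gen) := C.arc_gen.isMDS C.finrank_plane

theorem isMDS_hyper : IsMDS (evalAt K C.hyper) := IsArc.isMDS C.arc C.finrank_plane

theorem zeros_hyper (h : Module.Dual K W) :
    zeros (evalAt K C.hyper) h = zeros (evalAt K C.gen) h + if h C.nuc = 0 then 1 else 0 := by
  rw [zeros, zeros, Finset.card_filter, Finset.card_filter, Fintype.sum_option, add_comm]
  rfl

/-- The zeros on the hyperoval number 0 or 2, so a single zero on the oval must be paired with one
at the nucleus. -/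
theorem zeros_gen_eq_one_iff {h : Module.Dual K W} (hh : h ≠ 0) :
    zeros (evalAt K C.gen) h = 1 ↔ h C.nuc = 0 := by
  have h1 := C.zeros_hyper h
  rcases C.isMDS_hyper.zeros_eq C.card_hyper hh with h2 | h2 <;> split_ifs at h1 with h3 <;>
    simp only [h3, iff_true, iff_false] <;> omega

theorem ncard_generators (g h : Module.Dual K W) :
    {i | g (C.gen i) = h (C.gen i)}.ncard = zeros (evalAt K C.gen) (g - h) := by
  rw [zeros, ← Set.ncard_coe_finset]
  congr 1
  ext i
  simp [evalAt_apply, sub_eq_zero]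

theorem circle_inter (g h : Module.Dual K W) : C.circle g ∩ C.circle h =
    (fun i => C.genPoint i (g (C.gen i))) '' {i | g (C.gen i) = h (C.gen i)} := by
  ext p
  simp only [Set.mem_inter_iff, Set.mem_image, Set.mem_ofPred_eq]
  constructor
  · rintro ⟨h1, h2⟩
    obtain ⟨i, rfl⟩ := C.mem_circle_iff.1 h1
    exact ⟨i, (C.genPoint_mem_circle_iff.1 h2).symm, rfl⟩
  · rintro ⟨i, hi, rfl⟩
    exact ⟨C.genPoint_mem_circle_iff.2 rfl, C.genPoint_mem_circle_iff.2 hi.symm⟩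

theorem ncard_circle_inter (g h : Module.Dual K W) :
    (C.circle g ∩ C.circle h).ncard = zeros (evalAt K C.gen) (g - h) := by
  rw [C.circle_inter, Set.ncard_image_of_injective _ (C.genPoint_graph_injective g),
    C.ncard_generators]

theorem tangent_iff (g h : Module.Dual K W) :
    (C.circle h = C.circle g ∨ (C.circle g ∩ C.circle h).ncard = 1) ↔ h C.nuc = g C.nuc := by
  have hK : 1 < Fintype.card K := Fintype.one_lt_card
  rw [C.ncard_circle_inter]
  by_cases hgh : g = h
  · simp [hgh]
  · rw [C.zeros_gen_eq_one_iff (sub_ne_zero.2 hgh), LinearMap.sub_apply, sub_eq_zero]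
    constructor
    · rintro (h1 | h1)
      · have h2 := C.ncard_circle_inter g h
        rw [h1, Set.inter_self, (C.isOvalOf_circle g).2.1, C.card_index.symm,
          Nat.card_eq_fintype_card, C.fintype_card_index] at h2
        have := C.isMDS_gen.zeros_le_two (sub_ne_zero.2 hgh)
        omega
      · exact h1.symm
    · exact fun h1 => .inr h1.symm

theorem circle_injective : Function.Injective C.circle := by
  intro g h hgh
  have hK : 1 < Fintype.card K := Fintype.one_lt_card
  by_contra hne
  have h2 := C.ncard_circle_inter g h
  rw [← hgh, Set.inter_self, (C.isOvalOf_circle g).2.1, C.card_index.symm,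
    Nat.card_eq_fintype_card, C.fintype_card_index] at h2
  have := C.isMDS_gen.zeros_le_two (sub_ne_zero.2 hne)
  omega

/-- Admitting the nucleus costs nothing: agreement there forces agreement at an oval vector. -/
theorem circle_inter_nonempty_iff (g h : Module.Dual K W) :
    (C.circle g ∩ C.circle h).Nonempty ↔ ∃ o, evalAt K C.hyper o g = evalAt K C.hyper o h := by
  rw [C.circle_inter, Set.image_nonempty]
  constructor
  · rintro ⟨i, hi⟩
    exact ⟨some i, hi⟩
  · rintro ⟨o, ho⟩
    cases o with
    | some i => exact ⟨i, ho⟩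
    | none =>
      by_cases hgh : g = h
      · obtain ⟨i⟩ := C.nonempty_index
        exact ⟨i, by simp [hgh]⟩
      · have h1 : (g - h) C.nuc = 0 := sub_eq_zero.2 ho
        rw [← C.zeros_gen_eq_one_iff (sub_ne_zero.2 hgh), ← C.ncard_generators] at h1
        exact Set.nonempty_of_ncard_ne_zero (by omega)

/-- The nucleus of a circle. -/
def nucleusOf (g : Module.Dual K W) : ℙ K V := C.point C.nuc C.nuc_ne_zero (g C.nuc)

theorem nucleusOf_eq_iff {g h : Module.Dual K W} :
    C.nucleusOf g = C.nucleusOf h ↔ g C.nuc = h C.nuc := by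
  rw [nucleusOf, nucleusOf, point_eq_iff]
  constructor
  · rintro ⟨a, h1, h2⟩
    have h3 : (a - 1) • C.nuc = 0 := by rw [sub_smul, h1, one_smul, sub_self]
    have ha := sub_eq_zero.1 ((smul_eq_zero.1 h3).resolve_right C.nuc_ne_zero)
    rw [← h2, ha, one_mul]
  · intro h
    exact ⟨1, by simp, by simp [h]⟩

theorem ncard_line_inter_circle_eq_one_iff (g : Module.Dual K W)
    {l : Projectivization.Subspace K V} (hl : IsLine l) (hle : l ≤ C.plane g) :
    ((l : Set (ℙ K V)) ∩ C.circle g).ncard = 1 ↔ C.nucleusOf g ∈ l := by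
  have hfin : Module.Finite K W := Module.finite_of_finrank_eq_succ C.finrank_plane
  set L := (Subspace.submodule l).comap (C.lift g) with hL
  have hmap : L.map (C.lift g) = Subspace.submodule l := by
    rw [hL, Submodule.map_comap_eq_of_le]
    rw [← C.submodule_plane]
    exact Subspace.submodule.monotone hle
  have hLrank : Module.finrank K L = 2 := by
    rw [← hl, ← hmap]
    exact (Submodule.equivMapOfInjective _ (C.lift_injective g) L).finrank_eq
  have hlt : L < ⊤ := by
    rw [lt_top_iff_ne_top]
    intro h
    rw [h, finrank_top, C.finrank_plane] at hLrank
    omega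
  obtain ⟨f, hf0, hf⟩ := Submodule.exists_le_ker_of_lt_top L hlt
  have hker : L = LinearMap.ker f := by
    apply Submodule.eq_of_le_of_finrank_eq hf
    have := Module.Dual.finrank_ker_add_one_of_ne_zero hf0
    rw [C.finrank_plane] at this
    omega
  have hmem : ∀ x (hx : x ≠ 0), C.point x hx (g x) ∈ l ↔ f x = 0 := by
    intro x hx
    rw [← LinearMap.mem_ker, ← hker, hL, Submodule.mem_comap, lift_apply, point,
      ← Subspace.mem_submodule_iff]
  have hinter : (l : Set (ℙ K V)) ∩ C.circle g =
      (fun i => C.genPoint i (g (C.gen i))) '' {i | f (C.gen i) = (0 : Module.Dual K W) (C.gen i)} := by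
    ext p
    simp only [Set.mem_inter_iff, Set.mem_image, Set.mem_ofPred_eq, SetLike.mem_coe,
      LinearMap.zero_apply]
    constructor
    · rintro ⟨h1, h2⟩
      obtain ⟨i, rfl⟩ := C.mem_circle_iff.1 h2
      exact ⟨i, (hmem _ (C.gen_ne_zero i)).1 h1, rfl⟩
    · rintro ⟨i, hi, rfl⟩
      exact ⟨(hmem _ (C.gen_ne_zero i)).2 hi, C.genPoint_mem_circle_iff.2 rfl⟩
  rw [hinter, Set.ncard_image_of_injective _ (C.genPoint_graph_injective g), C.ncard_generators,
    sub_zero, C.zeros_gen_eq_one_iff hf0, nucleusOf, hmem]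

theorem nucleusOf_mem_plane (g : Module.Dual K W) : C.nucleusOf g ∈ C.plane g :=
  (C.point_mem_plane_iff C.nuc_ne_zero).2 rfl

theorem nucleusOf_not_mem_circle (g : Module.Dual K W) : C.nucleusOf g ∉ C.circle g := by
  intro h
  obtain ⟨i, b, hb⟩ := (C.mem_iff _ _ _).1 h.1
  exact one_ne_zero (C.nuc_pair i (1 : K) (-b) (by rw [hb]; module)).1

theorem plane_unique {g : Module.Dual K W} {π : Projectivization.Subspace K V} (hπ : IsPlane π)
    (hsub : C.circle g ⊆ π) : π = C.plane g := by
  have hK : 1 < Fintype.card K := Fintype.one_lt_card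
  obtain ⟨i, j, k, hij, hik, hjk⟩ := Fintype.two_lt_card_iff.1
    (show 2 < Fintype.card ι by rw [C.fintype_card_index]; omega)
  have hli := C.linearIndependent_lift g hij hik hjk
  have key : ∀ σ : Projectivization.Subspace K V, IsPlane σ → C.circle g ⊆ σ →
      Subspace.submodule σ = Submodule.span K
        (Set.range ![C.lift g (C.gen i), C.lift g (C.gen j), C.lift g (C.gen k)]) := by
    intro σ hσ hsubσ
    have hfin : Module.Finite K (Subspace.submodule σ) := Module.finite_of_finrank_eq_succ hσ
    have hmem : ∀ i, C.lift g (C.gen i) ∈ Subspace.submodule σ := fun i =>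
      (Subspace.mem_submodule_iff _ (C.chart_ne_zero (C.gen_ne_zero i) _)).2
        (hsubσ (C.mem_circle_iff.2 ⟨i, rfl⟩))
    refine (Submodule.eq_of_le_of_finrank_eq ?_ ?_).symm
    · rw [Submodule.span_le]
      rintro _ ⟨m, rfl⟩
      fin_cases m
      · exact hmem i
      · exact hmem j
      · exact hmem k
    · rw [finrank_span_eq_card hli, Fintype.card_fin, hσ]
  apply Subspace.submodule.injective
  rw [key π hπ hsub, key _ (C.isPlane_plane g) Set.inter_subset_right]

theorem isNucleus_circle_iff {g : Module.Dual K W} {N : ℙ K V} :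
    IsNucleus (C.circle g) N ↔ N = C.nucleusOf g := by
  constructor
  · rintro ⟨π, hπ, ho, hN, -, htan⟩
    obtain rfl := C.plane_unique hπ ho.1
    have hNl : ∀ (l : Projectivization.Subspace K V), IsLine l → l ≤ C.plane g →
        C.nucleusOf g ∈ l → N ∈ l := fun l hl hle hmem =>
      (htan l hl hle).1 ((C.ncard_line_inter_circle_eq_one_iff g hl hle).2 hmem)
    rcases C.eq_vertex_or_point N with rfl | ⟨x, hx, t, rfl⟩
    · exact absurd hN (C.vertex_not_mem_plane g)
    rw [C.point_mem_plane_iff] at hN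
    subst hN
    -- The line joining an oval point to `nucleusOf g` is tangent, so it contains N. Two such lines
    -- meet only in `nucleusOf g`.
    have hspan : ∀ i, ∃ a b : K, x = a • C.gen i + b • C.nuc := by
      intro i
      have hli : LinearIndependent K ![C.lift g (C.gen i), C.lift g C.nuc] := by
        rw [LinearIndependent.pair_iff]
        intro a b hab
        rw [← map_smul, ← map_smul, ← map_add, map_eq_zero_iff _ (C.lift_injective g)] at hab
        exact (C.nuc_pair i b a (by rw [add_comm, hab])).symm
      have hle : (Submodule.span K {C.lift g (C.gen i), C.lift g C.nuc}).projectivization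
          ≤ C.plane g := by
        apply Submodule.projectivization.monotone
        rw [Submodule.span_le]
        rintro v (rfl | rfl)
        · exact ⟨_, rfl⟩
        · exact ⟨_, rfl⟩
      have h1 := hNl _ (isLine_span hli) hle (Submodule.subset_span (by simp [lift_apply]))
      obtain ⟨a, b, hab⟩ := Submodule.mem_span_pair.1 h1
      refine ⟨a, b, C.lift_injective g ?_⟩
      rw [map_add, map_smul, map_smul, hab]
      rfl
    obtain ⟨i⟩ := C.nonempty_index
    obtain ⟨j, hij⟩ := C.exists_ne i
    obtain ⟨a, b, hab⟩ := hspan i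
    obtain ⟨a', b', hab'⟩ := hspan j
    obtain ⟨-, ha, -⟩ := C.arc_nuc hij (b - b') a (-a') (by
      have h2 := sub_eq_zero.2 (hab.symm.trans hab')
      rw [← h2]
      module)
    rw [nucleusOf, point_eq_iff]
    refine ⟨b, ?_, ?_⟩
    · rw [hab, ha]
      module
    · rw [hab, ha]
      simp
  · rintro rfl
    exact ⟨C.plane g, C.isPlane_plane g, C.isOvalOf_circle g, C.nucleusOf_mem_plane g,
      C.nucleusOf_not_mem_circle g, fun l hl hle => C.ncard_line_inter_circle_eq_one_iff g hl hle⟩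

theorem exists_eq_image {F : Set (Set (ℙ K V))} (hF : F ⊆ circles Q) :
    ∃ G : Finset (Module.Dual K W), F = C.circle '' G := by
  classical
  refine ⟨Finset.univ.filter fun g => C.circle g ∈ F, ?_⟩
  ext c
  simp only [Finset.coe_filter, Finset.mem_univ, true_and, Set.mem_image, Set.mem_ofPred_eq]
  constructor
  · intro hc
    obtain ⟨g, rfl⟩ := C.mem_circles_iff.1 (hF hc)
    exact ⟨g, hc, rfl⟩
  · rintro ⟨g, hg, rfl⟩
    exact hg

theorem isIntersectingFamily_image_iff (G : Finset (Module.Dual K W)) :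
    IsIntersectingFamily Q (C.circle '' G) ↔ Agreeing (evalAt K C.hyper) G := by
  constructor
  · intro h g hg k hk
    rw [← C.circle_inter_nonempty_iff]
    exact h.2 _ ⟨g, hg, rfl⟩ _ ⟨k, hk, rfl⟩
  · intro h
    refine ⟨?_, ?_⟩
    · rintro _ ⟨g, -, rfl⟩
      exact C.circle_mem_circles g
    · rintro _ ⟨g, hg, rfl⟩ _ ⟨k, hk, rfl⟩
      rw [C.circle_inter_nonempty_iff]
      exact h g hg k hk

theorem ncard_image (G : Finset (Module.Dual K W)) : (C.circle '' (G : Set _)).ncard = G.card := by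
  rw [Set.ncard_image_of_injective _ C.circle_injective, Set.ncard_coe_finset]

theorem sep_circles (p : Set (ℙ K V) → Prop) :
    {c | c ∈ circles Q ∧ p c} = C.circle '' {g | p (C.circle g)} := by
  ext c
  simp only [C.mem_circles_iff, Set.mem_image, Set.mem_ofPred_eq]
  constructor
  · rintro ⟨⟨g, rfl⟩, h⟩
    exact ⟨g, h, rfl⟩
  · rintro ⟨g, h, rfl⟩
    exact ⟨⟨g, rfl⟩, h⟩

theorem isPointPencil_iff {F : Set (Set (ℙ K V))} :
    IsPointPencil Q F ↔ ∃ i t, F = C.circle '' {g | g (C.gen i) = t} := by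
  simp only [IsPointPencil, C.mem_points_iff, C.sep_circles]
  constructor
  · rintro ⟨_, ⟨i, t, rfl⟩, rfl⟩
    exact ⟨i, t, by simp only [C.genPoint_mem_circle_iff]⟩
  · rintro ⟨i, t, rfl⟩
    exact ⟨_, ⟨i, t, rfl⟩, by simp only [C.genPoint_mem_circle_iff]⟩

theorem isTangentFamily_iff {F : Set (Set (ℙ K V))} :
    IsTangentFamily Q F ↔ ∃ g : Module.Dual K W, F = C.circle '' {h | h C.nuc = g C.nuc} := by
  simp only [IsTangentFamily, C.mem_circles_iff]
  have key : ∀ g, {d | (∃ h, d = C.circle h) ∧ (d = C.circle g ∨ (C.circle g ∩ d).ncard = 1)}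
      = C.circle '' {h | h C.nuc = g C.nuc} := by
    intro g
    have := C.sep_circles fun d => d = C.circle g ∨ (C.circle g ∩ d).ncard = 1
    simp only [C.mem_circles_iff, C.tangent_iff] at this
    exact this
  constructor
  · rintro ⟨_, ⟨g, rfl⟩, rfl⟩
    exact ⟨g, key g⟩
  · rintro ⟨g, rfl⟩
    exact ⟨_, ⟨g, rfl⟩, (key g).symm⟩

theorem isNucleusFamily_iff {F : Set (Set (ℙ K V))} :
    IsNucleusFamily Q F ↔ ∃ g : Module.Dual K W, F = C.circle '' {h | h C.nuc = g C.nuc} := by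
  have key : ∀ g, {c | c ∈ circles Q ∧ IsNucleus c (C.nucleusOf g)}
      = C.circle '' {h | h C.nuc = g C.nuc} := by
    intro g
    rw [C.sep_circles]
    simp only [C.isNucleus_circle_iff, C.nucleusOf_eq_iff, eq_comm]
  constructor
  · rintro ⟨N, ⟨c, hc, hN⟩, rfl⟩
    obtain ⟨g, rfl⟩ := C.mem_circles_iff.1 hc
    rw [C.isNucleus_circle_iff] at hN
    subst hN
    exact ⟨g, key g⟩
  · rintro ⟨g, rfl⟩
    exact ⟨C.nucleusOf g, ⟨_, C.circle_mem_circles g, C.isNucleus_circle_iff.2 rfl⟩, (key g).symm⟩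

/-- Every scalar is the value at the nucleus of some functional, so tangent families are all the
fibres of that form, just as pencils are those of the other forms. -/
theorem isTangentFamily_iff_eq {F : Set (Set (ℙ K V))} :
    IsTangentFamily Q F ↔ ∃ t, F = C.circle '' {h | h C.nuc = t} := by
  rw [C.isTangentFamily_iff]
  constructor
  · rintro ⟨g, rfl⟩
    exact ⟨_, rfl⟩
  · rintro ⟨t, rfl⟩
    obtain ⟨i⟩ := C.nonempty_index
    obtain ⟨j, hij⟩ := C.exists_ne i
    obtain ⟨g, hg⟩ := (C.isMDS_hyper none (some i) (some j) (by simp) (by simp) (by simpa)).2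
      (t, 0, 0)
    have hgt : g C.nuc = t := congrArg Prod.fst hg
    exact ⟨g, by rw [hgt]⟩

theorem pencil_or_tangent_iff {F : Set (Set (ℙ K V))} :
    IsPointPencil Q F ∨ IsTangentFamily Q F ↔
      ∃ o t, F = C.circle '' {h | evalAt K C.hyper o h = t} := by
  rw [C.isPointPencil_iff, C.isTangentFamily_iff_eq]
  constructor
  · rintro (⟨i, t, rfl⟩ | ⟨t, rfl⟩)
    · exact ⟨some i, t, rfl⟩
    · exact ⟨none, t, rfl⟩
  · rintro ⟨_ | i, t, rfl⟩
    · exact .inr ⟨t, rfl⟩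
    · exact .inl ⟨i, t, rfl⟩

theorem ncard_le {F : Set (Set (ℙ K V))} (hF : IsIntersectingFamily Q F) :
    F.ncard ≤ Fintype.card K ^ 2 := by
  obtain ⟨G, rfl⟩ := C.exists_eq_image hF.1
  rw [C.ncard_image]
  exact C.isMDS_hyper.card_le C.card_hyper ((C.isIntersectingFamily_image_iff G).1 hF)

theorem maximal_iff (hK : 2 < Fintype.card K) {F : Set (Set (ℙ K V))} :
    IsIntersectingFamily Q F ∧ F.ncard = Fintype.card K ^ 2 ↔
      IsPointPencil Q F ∨ IsTangentFamily Q F := by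
  rw [C.pencil_or_tangent_iff]
  constructor
  · rintro ⟨hF, hc⟩
    obtain ⟨G, rfl⟩ := C.exists_eq_image hF.1
    rw [C.ncard_image] at hc
    obtain ⟨o, t, rfl⟩ := C.isMDS_hyper.eq_fiber_of_card_eq C.card_hyper hK
      ((C.isIntersectingFamily_image_iff G).1 hF) hc
    exact ⟨o, t, by simp⟩
  · rintro ⟨o, t, rfl⟩
    have h1 : {h : Module.Dual K W | evalAt K C.hyper o h = t} =
        (({h | evalAt K C.hyper o h = t} : Finset (Module.Dual K W)) : Set _) := by simp
    rw [h1, C.isIntersectingFamily_image_iff, C.ncard_image]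
    refine ⟨fun g hg h hh => ⟨o, ?_⟩, C.isMDS_hyper.card_fiber (by rw [C.card_hyper]; omega) o t⟩
    rw [(Finset.mem_filter.1 hg).2, (Finset.mem_filter.1 hh).2]

end Counting

end ConeFrame

/-! ### Existence of coordinates for an oval cone. -/

section Construction

variable {K V : Type*} [Field K] [Finite K] [AddCommGroup V] [Module K V]

theorem IsOvalOf.isArc {π : Projectivization.Subspace K V} {O : Set (ℙ K V)} (hO : IsOvalOf π O) :
    IsArc (K := K) fun P : O => P.1.rep := by
  intro i j k hij hik hjk
  have h := hO.2.2 i.1 i.2 j.1 j.2 k.1 k.2 (fun e => hij (Subtype.ext e))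
    (fun e => hik (Subtype.ext e)) (fun e => hjk (Subtype.ext e))
  rw [← mk_rep i.1, ← mk_rep j.1, ← mk_rep k.1, isCollinear_triple_iff, not_not,
    linearIndependent_triple_iff] at h
  exact h

/-- Over a field of even order, every oval cone of a three-space has a frame. -/
theorem IsOvalCone.exists_frame (hV : Module.finrank K V = 4) (hK : Even (Nat.card K))
    {Q : Set (ℙ K V)} (hQ : IsOvalCone Q) :
    ∃ (U : Submodule K V) (O : Set (ℙ K V)), Nonempty (ConeFrame Q U O) := by
  classical
  obtain ⟨R, π, O, hπ, hR, hO, rfl⟩ := hQ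
  have hfinV : Module.Finite K V := Module.finite_of_finrank_eq_succ hV
  set U := Subspace.submodule π with hU
  have hUrank : Module.finrank K U = 3 := hπ
  have hOfin : Finite O := Nat.finite_of_card_ne_zero (by
    rw [Nat.card_coe_set_eq, hO.2.1]; omega)
  have hRU : R.rep ∉ U := fun h => hR (by
    rw [← mk_rep R, ← Subspace.mem_submodule_iff]
    exact h)
  have hOU : ∀ P : O, P.1.rep ∈ U := fun P => by
    rw [hU, Subspace.mem_submodule_iff _ P.1.rep_nonzero, mk_rep]
    exact hO.1 P.2
  -- The vertex lies off the plane of the oval, so plane and vertex span the four-space as a direct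
  -- sum.
  set f : (U × K) →ₗ[K] V := U.subtype.coprod (LinearMap.toSpanSingleton K V R.rep) with hf
  have hfapply : ∀ x t, f (x, t) = (x : V) + t • R.rep := fun x t => by
    simp [hf]
  have hfinj : Function.Injective f := by
    rw [← LinearMap.ker_eq_bot, LinearMap.ker_eq_bot']
    rintro ⟨x, t⟩ hxt
    rw [hfapply] at hxt
    have ht : t = 0 := by
      by_contra ht
      apply hRU
      have h1 : R.rep = t⁻¹ • (-(x : V)) := by
        rw [eq_inv_smul_iff₀ ht, eq_neg_iff_add_eq_zero, add_comm, hxt]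
      rw [h1]
      exact U.smul_mem _ (U.neg_mem x.2)
    subst ht
    simpa using hxt
  let e : (U × K) ≃ₗ[K] V := f.linearEquivOfInjective hfinj (by
    rw [Module.finrank_prod, hUrank, hV, Module.finrank_self])
  have he : ∀ x t, e (x, t) = (x : V) + t • R.rep := fun x t => hfapply x t
  let gen : O → U := fun P => ⟨P.1.rep, hOU P⟩
  have harc : IsArc (K := K) gen := fun i j k hij hik hjk a b c h =>
    hO.isArc i j k hij hik hjk a b c (by simpa using congrArg Subtype.val h)
  have : Fintype K := Fintype.ofFinite K
  have : Fintype O := Fintype.ofFinite O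
  have : Finite (Module.Dual K U) := Module.finite_of_finite K
  have : Fintype (Module.Dual K U) := Fintype.ofFinite _
  obtain ⟨n, hn⟩ := harc.exists_nucleus hUrank
    (by rw [← Nat.card_eq_fintype_card, ← Nat.card_eq_fintype_card, Nat.card_coe_set_eq, hO.2.1])
    (by rwa [← Nat.card_eq_fintype_card])
  refine ⟨U, O, ⟨⟨e, gen, n, hn, ?_, hUrank, by rw [Nat.card_coe_set_eq, hO.2.1]⟩⟩⟩
  intro x t h
  simp only [Set.mem_iUnion, SetLike.mem_coe]
  constructor
  · rintro ⟨P, hP, hmem⟩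
    rw [← mk_rep R, ← mk_rep P, mk_mem_span_pair_iff] at hmem
    obtain ⟨a, b, hab⟩ := hmem
    refine ⟨⟨P, hP⟩, b, ?_⟩
    have h1 : e (b • gen ⟨P, hP⟩, a) = e (x, t) := by
      rw [← hab, he, add_comm]
      rfl
    exact (congrArg Prod.fst (e.injective h1)).symm
  · rintro ⟨P, b, rfl⟩
    refine ⟨P.1, P.2, ?_⟩
    rw [← mk_rep R, ← mk_rep P.1, mk_mem_span_pair_iff]
    refine ⟨t, b, ?_⟩
    rw [he, add_comm]
    rfl

end Construction

end CircleGeometry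

theorem theorem1p5 {K : Type*} [Field K] [Finite K] (q : ℕ) (hKq : Nat.card K = q)
    (hq : 2 < q) (hqe : Even q)
    (Q : Set (ℙ K (Fin 4 → K))) (hQ : CircleGeometry.IsOvalCone Q) :
    (∀ F : Set (Set (ℙ K (Fin 4 → K))), CircleGeometry.IsIntersectingFamily Q F →
      F.ncard ≤ q ^ 2) ∧
    (∀ F : Set (Set (ℙ K (Fin 4 → K))),
      (CircleGeometry.IsIntersectingFamily Q F ∧ F.ncard = q ^ 2) ↔
        (CircleGeometry.IsPointPencil Q F ∨ CircleGeometry.IsTangentFamily Q F)) ∧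
    (∀ F : Set (Set (ℙ K (Fin 4 → K))),
      CircleGeometry.IsTangentFamily Q F ↔ CircleGeometry.IsNucleusFamily Q F) := by
  classical
  subst hKq
  obtain ⟨U, O, ⟨C⟩⟩ := hQ.exists_frame (by simp) hqe
  have : Finite O := C.finite_index
  have : Fintype K := Fintype.ofFinite K
  have : Fintype O := Fintype.ofFinite O
  have : Finite (Module.Dual K U) := Module.finite_of_finite K
  have : Fintype (Module.Dual K U) := Fintype.ofFinite _
  rw [Nat.card_eq_fintype_card] at hq ⊢
  exact ⟨fun F hF => C.ncard_le hF, fun F => C.maximal_iff hq,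
    fun F => C.isTangentFamily_iff.trans C.isNucleusFamily_iff.symm⟩
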